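/- Let $G$ be a finite simple connected graph with $m$ edges. A strong rainbow coloring of $G$ is a coloring of its edges (adjacent edges may receive the same color) such that any two vertices $u,v$ are joined by a path of length $d(u,v)$ on which no two edges have the same color; $src(G)$ denotes the smallest number of colors in a strong rainbow coloring of $G$. A unicyclic graph is a connected graph with exactly one cycle. If $G$ is unicyclic with cycle $C$ on the vertices $v_1,\dots,v_k$ (in this order around $C$), let $T_i$ be the component containing $v_i$ of the graph $G\setminus E(C)$ obtained from $G$ by deleting the edges of $C$; it is a tree, called trivial if it consists of $v_i$ alone, and we say that it is a pendant path if it is a path having $v_i$ as an end vertex. Define the following classes of unicyclic graphs: - $\mathcal G_1$: $k=3$ and at most two of $T_1,T_2,T_3$ are nontrivial; - $\mathcal G_2$: $k=4$, exactly two of the $T_i$ are nontrivial, they are attached at vertices that are not adjacent on $C$, and each of them is a pendant path; - $\mathcal G_3$: $k=4$, at most one of the $T_i$ is nontrivial, and the nontrivial one (if it exists) is a pendant path. **Theorem.** $src(G)\le m-2$ if and only if $G$ is not a tree, and $src(G)=m-1$ never happens. Moreover, $src(G)=m-2$ if and only if $G$ is a 5-cycle or $G$ belongs to one of the classes $\mathcal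 G_1,\mathcal G_2,\mathcal G_3$. -/

import Mathlib

namespace StrongRainbow

open SimpleGraph

universe u

variable {V : Type u} {G : SimpleGraph V}

/-- No two edges of the walk `p` have the same color under the edge-coloring `c`. -/
def IsRainbow {K : Type*} (c : G.EdgeLabeling K) {x y : V} (p : G.Walk x y) : Prop :=
  ∀ e f : G.edgeSet, (e : Sym2 V) ∈ p.edges → (f : Sym2 V) ∈ p.edges → c e = c f → e = f

/-- The edge-coloring `c` makes `G` strongly rainbow connected: any two vertices are joined by
a rainbow geodesic. -/
def IsStrongRainbow {K : Type*} (c : G.EdgeLabeling K) : Prop :=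
  ∀ x y : V, ∃ p : G.Walk x y, p.IsPath ∧ p.length = G.dist x y ∧ IsRainbow c p

/-- The strong rainbow connection number: the smallest number of colors that allows a strong
rainbow coloring (meaningful for finite connected graphs). -/
noncomputable def src (G : SimpleGraph V) : ℕ :=
  sInf {n : ℕ | ∃ c : G.EdgeLabeling (Fin n), IsStrongRainbow c}

/-- The minimum defining `src` is taken over a nonempty set, so it is attained. -/
theorem exists_isStrongRainbow_src [Finite V] (hG : G.Connected) :
    ∃ c : G.EdgeLabeling (Fin (src G)), IsStrongRainbow c := by
  obtain ⟨n, ⟨φ⟩⟩ := Finite.exists_equiv_fin G.edgeSet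
  refine Nat.sInf_mem (s := {n : ℕ | ∃ c : G.EdgeLabeling (Fin n), IsStrongRainbow c})
    ⟨n, fun e => φ e, fun x y => ?_⟩
  obtain ⟨p, hp, hl⟩ := hG.exists_path_of_dist x y
  exact ⟨p, hp, hl, fun e f _ _ h => φ.injective h⟩

/-- `C` is a cycle of `G`, and every cycle of `G` is the same subgraph as `C`. -/
def IsUniqueCycle {v : V} (C : G.Walk v v) : Prop :=
  C.IsCycle ∧ ∀ (w : V) (D : G.Walk w w), D.IsCycle → D.toSubgraph = C.toSubgraph

/-- The graph `G \ E(C)`. -/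
def removeCycle {v : V} (C : G.Walk v v) : SimpleGraph V :=
  G.deleteEdges C.edgeSet

/-- The component `T_x` of `G \ E(C)` containing `x`. When `C` is the unique cycle of `G`, it is
a tree. -/
def tree {v : V} (C : G.Walk v v) (x : V) : (removeCycle C).Subgraph :=
  ((removeCycle C).connectedComponentMk x).toSubgraph

/-- `T_x` has more than one vertex. -/
def NontrivialTree {v : V} (C : G.Walk v v) (x : V) : Prop :=
  (tree C x).verts.Nontrivial

/-- `T_x` is a path with `x` as one of its end vertices. -/
def PathTree {v : V} (C : G.Walk v v) (x : V) : Prop :=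
  ∃ (y : V) (p : (removeCycle C).Walk x y), p.IsPath ∧ p.toSubgraph = tree C x

/-- The vertices of `C` at which a nontrivial tree is attached. -/
def nontrivialRoots {v : V} (C : G.Walk v v) : Set V :=
  {x | x ∈ C.support ∧ NontrivialTree C x}

/-- Unicyclic, the cycle is a triangle, at most two of the trees are nontrivial. -/
def ClassG1 (G : SimpleGraph V) : Prop :=
  G.Connected ∧ ∃ (v : V) (C : G.Walk v v), IsUniqueCycle C ∧ C.length = 3 ∧
    (nontrivialRoots C).encard ≤ 2

/-- Unicyclic, the cycle has length 4, exactly two of the trees are nontrivial, they are attached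
at nonadjacent vertices of the cycle, and each of them is a path starting on the cycle. -/
def ClassG2 (G : SimpleGraph V) : Prop :=
  G.Connected ∧ ∃ (v : V) (C : G.Walk v v), IsUniqueCycle C ∧ C.length = 4 ∧
    ∃ x y : V, x ≠ y ∧ ¬ C.toSubgraph.Adj x y ∧ nontrivialRoots C = {x, y} ∧
      PathTree C x ∧ PathTree C y

/-- Unicyclic, the cycle has length 4, at most one of the trees is nontrivial, and if there is
one, then it is a path starting on the cycle. -/
def ClassG3 (G : SimpleGraph V) : Prop :=
  G.Connected ∧ ∃ (v : V) (C : G.Walk v v), IsUniqueCycle C ∧ C.length = 4 ∧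
    (nontrivialRoots C).encard ≤ 1 ∧ ∀ x ∈ nontrivialRoots C, PathTree C x

end StrongRainbow

/-! Start from the coloring in which every edge has its own color and merge colors. Merging is
harmless if every two vertices have one geodesic on which no color repeats (`src_add_card_le`). By
`exists_potential` a geodesic is an isometric copy of a segment of the line, so edges ab, cd with
d(a,c) + d(b,d) ≠ d(a,d) + d(b,c) never share one. This Djoković–Winkler relation supplies most
merged pairs; the others share some geodesics, which can be rerouted around a four-cycle.

In a graph that is not a tree, take a shortest cycle. Its antipodal edges are related, which saves
two colors from length 4 on and three from length 6 on; a triangle can be made monochromatic, which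
saves two. This gives src ≤ m - 2.

Suppose no third color can be saved. At length 5, an edge leaving the cycle would save one, so the
graph is the cycle. At length 3 or 4, no two edges off the cycle may be related, and no K_{2,3} may
occur; a second cycle would force one of these (`isUniqueCycle_of_shortest`), so the graph is
unicyclic. Local configurations then restrict the attached trees: three nontrivial trees on a
triangle, nontrivial trees at adjacent vertices of a four-cycle, or a branching tree there, each
save a third color.

The lower bounds come from forests whose edges need distinct colors (`ncard_edgeSet_le_src`; trees
and `ClassG1`), from the distance between two vertices (`dist_le_src`; `ClassG2` and `ClassG3`), and
from the odd length of the five-cycle. -/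

namespace StrongRainbow

open SimpleGraph

universe u

variable {V : Type u} {G : SimpleGraph V}

/-! ### Geodesics -/

/-- Cutting the geodesic at u and v gives three walks of total length d(x,y); the triangle
inequality forces each to be a geodesic. The two cases are the two orders of u and v. -/
theorem geodesic_split (hG : G.Connected) {x y : V} {p : G.Walk x y}
    (hp : p.length = G.dist x y) {u v : V} (hu : u ∈ p.support) (hv : v ∈ p.support) :
    G.dist x y = G.dist x u + G.dist u v + G.dist v y ∨
      G.dist x y = G.dist x v + G.dist u v + G.dist u y := by
  classical
  have key : ∀ {u v : V} (p₁ : G.Walk x u) (p₂ : G.Walk u v) (p₃ : G.Walk v y),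
      p₁.length + p₂.length + p₃.length = G.dist x y →
      G.dist x y = G.dist x u + G.dist u v + G.dist v y := by
    intro u v p₁ p₂ p₃ h
    have h₁ := dist_le p₁
    have h₂ := dist_le p₂
    have h₃ := dist_le p₃
    have h₄ := hG.dist_triangle (u := x) (v := u) (w := y)
    have h₅ := hG.dist_triangle (u := u) (v := v) (w := y)
    omega
  have hlen := congrArg Walk.length (p.take_spec hu)
  rw [Walk.length_append] at hlen
  rw [← p.take_spec hu, Walk.mem_support_append_iff] at hv
  rcases hv with hv | hv
  · have h := congrArg Walk.length ((p.takeUntil u hu).take_spec hv)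
    rw [Walk.length_append] at h
    right
    rw [dist_comm (u := u) (v := v)]
    exact key ((p.takeUntil u hu).takeUntil v hv) ((p.takeUntil u hu).dropUntil v hv)
      (p.dropUntil u hu) (by omega)
  · have h := congrArg Walk.length ((p.dropUntil u hu).take_spec hv)
    rw [Walk.length_append] at h
    left
    exact key (p.takeUntil u hu) ((p.dropUntil u hu).takeUntil v hv)
      ((p.dropUntil u hu).dropUntil v hv) (by omega)

/-- The distance from the start identifies the vertices of a geodesic with points of a line. -/
theorem exists_potential (hG : G.Connected) {x y : V} {p : G.Walk x y}
    (hp : p.length = G.dist x y) :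
    ∃ φ : V → ℕ, ∀ u ∈ p.support, ∀ v ∈ p.support,
      φ u = φ v + G.dist u v ∨ φ v = φ u + G.dist u v := by
  refine ⟨G.dist x, fun u hu v hv => ?_⟩
  have h₁ := hG.dist_triangle (u := x) (v := u) (w := v)
  have h₂ := hG.dist_triangle (u := x) (v := v) (w := u)
  have h₃ := hG.dist_triangle (u := x) (v := u) (w := y)
  have h₄ := hG.dist_triangle (u := x) (v := v) (w := y)
  have h₅ := dist_comm (G := G) (u := u) (v := v)
  rcases geodesic_split hG hp hu hv with h | h <;> omega

theorem exists_geodesic_through (hG : G.Connected) {x y : V} {p : G.Walk x y}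
    (hp : p.length = G.dist x y) {a b z : V} (ha : a ∈ p.support) (hb : b ∈ p.support)
    (hz : G.dist a z + G.dist z b = G.dist a b) :
    ∃ q : G.Walk x y, q.length = G.dist x y ∧ a ∈ q.support ∧ z ∈ q.support ∧ b ∈ q.support := by
  have key : ∀ {a b : V}, G.dist a z + G.dist z b = G.dist a b →
      G.dist x y = G.dist x a + G.dist a b + G.dist b y →
      ∃ q : G.Walk x y,
        q.length = G.dist x y ∧ a ∈ q.support ∧ z ∈ q.support ∧ b ∈ q.support := by
    intro a b hz h
    obtain ⟨q₁, h₁⟩ := hG.exists_walk_length_eq_dist x a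
    obtain ⟨q₂, h₂⟩ := hG.exists_walk_length_eq_dist a z
    obtain ⟨q₃, h₃⟩ := hG.exists_walk_length_eq_dist z b
    obtain ⟨q₄, h₄⟩ := hG.exists_walk_length_eq_dist b y
    refine ⟨q₁.append (q₂.append (q₃.append q₄)), ?_, ?_, ?_, ?_⟩
    · simp only [Walk.length_append]
      omega
    all_goals simp [Walk.mem_support_append_iff]
  rcases geodesic_split hG hp ha hb with h | h
  · exact key hz h
  · rw [dist_comm (u := a) (v := b)] at h hz
    rw [dist_comm (u := a) (v := z), dist_comm (u := z) (v := b), add_comm] at hz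
    obtain ⟨q, hq, h₁, h₂, h₃⟩ := key hz h
    exact ⟨q, hq, h₃, h₂, h₁⟩

/-- Certifies lower bounds on distances by an explicit function on the vertices. -/
theorem dist_le_of_lipschitz (hG : G.Connected) (ψ : V → ℤ)
    (hψ : ∀ u v, G.Adj u v → ψ v ≤ ψ u + 1) (x y : V) : ψ y - ψ x ≤ G.dist x y := by
  obtain ⟨p, hp⟩ := hG.exists_walk_length_eq_dist x y
  rw [← hp]
  clear hp
  induction p with
  | nil => simp
  | cons h p ih =>
    have := hψ _ _ h
    rw [Walk.length_cons]
    push_cast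
    omega

theorem exists_adj_dist_succ (hG : G.Connected) {x y : V} (h : x ≠ y) :
    ∃ z, G.Adj x z ∧ G.dist x y = G.dist z y + 1 := by
  obtain ⟨p, hp⟩ := hG.exists_walk_length_eq_dist x y
  cases p with
  | nil => exact absurd rfl h
  | @cons _ z _ hadj q =>
    refine ⟨z, hadj, ?_⟩
    have h₁ := dist_le q
    rw [Walk.length_cons] at hp
    have h₂ := hG.dist_triangle (u := x) (v := z) (w := y)
    have h₃ := dist_eq_one_iff_adj.2 hadj
    omega

/-- No geodesic of `G` uses both edges. -/
def NoCommonGeodesic (G : SimpleGraph V) (e f : Sym2 V) : Prop :=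
  ∀ (x y : V) (p : G.Walk x y), p.length = G.dist x y → e ∈ p.edges → f ∉ p.edges

/-- Edges in Djoković–Winkler relation do not lie on a common geodesic. -/
theorem noCommonGeodesic_of_dist (hG : G.Connected) {a b c d : V} (hab : G.Adj a b)
    (hcd : G.Adj c d) (hne : s(a, b) ≠ s(c, d))
    (h : G.dist a c + G.dist b d ≠ G.dist a d + G.dist b c) :
    NoCommonGeodesic G s(a, b) s(c, d) := by
  intro x y p hp h₁ h₂
  obtain ⟨φ, hφ⟩ := exists_potential hG hp
  have ha := p.fst_mem_support_of_mem_edges h₁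
  have hb := p.snd_mem_support_of_mem_edges h₁
  have hc := p.fst_mem_support_of_mem_edges h₂
  have hd := p.snd_mem_support_of_mem_edges h₂
  have h₃ := hφ a ha b hb
  have h₄ := hφ c hc d hd
  rw [dist_eq_one_iff_adj.2 hab] at h₃
  rw [dist_eq_one_iff_adj.2 hcd] at h₄
  have hac := hφ a ha c hc
  have had := hφ a ha d hd
  have hbc := hφ b hb c hc
  have hbd := hφ b hb d hd
  have e₁ : G.dist a c = 0 → a = c := hG.dist_eq_zero_iff.1
  have e₂ : G.dist a d = 0 → a = d := hG.dist_eq_zero_iff.1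
  have e₃ : G.dist b c = 0 → b = c := hG.dist_eq_zero_iff.1
  have e₄ : G.dist b d = 0 → b = d := hG.dist_eq_zero_iff.1
  -- On the line the two edges are unit intervals with integer ends. The two sums of distances
  -- differ only if these intervals coincide, and then the edges are equal.
  have : ¬ (G.dist a c = 0 ∧ G.dist b d = 0) := fun ⟨h, h'⟩ => hne (by rw [e₁ h, e₄ h'])
  have : ¬ (G.dist a d = 0 ∧ G.dist b c = 0) := fun ⟨h, h'⟩ =>
    hne (by rw [e₂ h, e₃ h', Sym2.eq_swap])
  omega

/-- Parity: on a line no integer is equidistant from two consecutive integers, so no geodesic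
contains both a and the edge cd. -/
theorem noCommonGeodesic_of_equidistant (hG : G.Connected) {a w c d : V}
    (hcd : G.Adj c d) (h : G.dist a c = G.dist a d) :
    NoCommonGeodesic G s(w, a) s(c, d) := by
  intro x y p hp h₁ h₂
  obtain ⟨φ, hφ⟩ := exists_potential hG hp
  have ha := p.snd_mem_support_of_mem_edges h₁
  have hc := p.fst_mem_support_of_mem_edges h₂
  have hd := p.snd_mem_support_of_mem_edges h₂
  have h₄ := hφ c hc d hd
  rw [dist_eq_one_iff_adj.2 hcd] at h₄
  have hac := hφ a ha c hc
  have had := hφ a ha d hd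
  omega

/-! ### Changing values along a walk -/

theorem exists_edge_ne_of_walk {H : SimpleGraph V} {α : Type*} (g : V → α) {u w : V}
    (p : H.Walk u w) (h : g u ≠ g w) : ∃ x y, s(x, y) ∈ p.edges ∧ H.Adj x y ∧ g x ≠ g y := by
  induction p with
  | nil => exact absurd rfl h
  | @cons u v w hadj p ih =>
    by_cases huv : g u = g v
    · obtain ⟨x, y, hp, hxy⟩ := ih (huv ▸ h)
      exact ⟨x, y, by simp [hp], hxy⟩
    · exact ⟨u, v, by simp, hadj, huv⟩

/-- The difference of the distances to the two ends of an edge. -/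
noncomputable def edgeDiff (G : SimpleGraph V) (a b x : V) : ℤ := G.dist a x - G.dist b x

/-- This form lets mates of ab be found by following `edgeDiff` along a walk: an edge across which
it changes is related to ab. -/
theorem noCommonGeodesic_of_edgeDiff_ne (hG : G.Connected) {a b c d : V} (hab : G.Adj a b)
    (hcd : G.Adj c d) (hne : s(a, b) ≠ s(c, d)) (h : edgeDiff G a b c ≠ edgeDiff G a b d) :
    NoCommonGeodesic G s(a, b) s(c, d) :=
  noCommonGeodesic_of_dist hG hab hcd hne (by unfold edgeDiff at h; omega)

/-- If no edge outside `S` is paired with an edge `ab ∉ S` which lies on a cycle, then two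
vertices touched by `S` are joined outside `S`. -/
theorem exists_mate_or_reachable (hG : G.Connected) (S : Set (Sym2 V)) (K : Set V)
    (hK : ∀ e ∈ S, ∀ x ∈ e, x ∈ K) {a b : V} (hab : G.Adj a b) (habS : s(a, b) ∉ S)
    (hbr : ¬ G.IsBridge s(a, b)) :
    (∃ f ∈ G.edgeSet, f ∉ S ∧ f ≠ s(a, b) ∧ NoCommonGeodesic G s(a, b) f) ∨
      ∃ x ∈ K, ∃ y ∈ K, x ≠ y ∧ (G.deleteEdges S).Reachable x y := by
  by_contra! hcon
  obtain ⟨h₁, h₂⟩ := hcon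
  rw [isBridge_iff, not_not] at hbr
  have hconst : ∀ c d, G.Adj c d → s(c, d) ∉ S → s(c, d) ≠ s(a, b) →
      edgeDiff G a b c = edgeDiff G a b d := by
    intro c d hcd hS hne
    by_contra h
    exact h₁ _ hcd hS hne (noCommonGeodesic_of_edgeDiff_ne hG hab hcd hne.symm h)
  -- A walk from a to b avoiding ab must change `edgeDiff` from -1 to 1. Without mates outside `S`,
  -- it can change only across an edge of `S`, so the first such edge is reached with the initial
  -- value. Applied from both ends, this yields two vertices of `K` with different values, joined
  -- through ab.
  have key : ∀ u w, (G.deleteEdges {s(a, b)}).Walk u w → edgeDiff G a b u ≠ edgeDiff G a b w →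
      ∃ k ∈ K, (G.deleteEdges S).Reachable u k ∧ edgeDiff G a b k = edgeDiff G a b u := by
    intro u w p
    induction p with
    | nil => exact fun h => absurd rfl h
    | @cons u v w hadj p ih =>
      intro hne
      rw [deleteEdges_adj, Set.mem_singleton_iff] at hadj
      by_cases hS : s(u, v) ∈ S
      · exact ⟨u, hK _ hS u (by simp), Reachable.refl _, rfl⟩
      · have h := hconst u v hadj.1 hS hadj.2
        obtain ⟨k, hk, hr, hd⟩ := ih (h ▸ hne)
        refine ⟨k, hk, Reachable.trans (Adj.reachable ?_) hr, hd.trans h.symm⟩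
        rw [deleteEdges_adj]
        exact ⟨hadj.1, hS⟩
  have hda : edgeDiff G a b a = -1 := by
    simp [edgeDiff, dist_eq_one_iff_adj.2 hab.symm]
  have hdb : edgeDiff G a b b = 1 := by
    simp [edgeDiff, dist_eq_one_iff_adj.2 hab]
  obtain ⟨p⟩ := hbr
  obtain ⟨k, hk, hrk, hdk⟩ := key _ _ p (by omega)
  obtain ⟨l, hl, hrl, hdl⟩ := key _ _ p.reverse (by omega)
  refine h₂ k hk l hl (fun h => ?_) (hrk.symm.trans (Reachable.trans (Adj.reachable ?_) hrl))
  · rw [h] at hdk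
    omega
  · rw [deleteEdges_adj]
    exact ⟨hab, habS⟩

/-- The first edge of a path in a subgraph is paired with a later edge of this path as soon as
the path ends no farther from its first vertex than from its second vertex. -/
theorem exists_mate_of_path (hG : G.Connected) (S : Set (Sym2 V)) {x u y : V}
    (h : (G.deleteEdges S).Adj x u) (p : (G.deleteEdges S).Walk u y) (hp : x ∉ p.support)
    (hd : G.dist x y ≤ G.dist u y) :
    ∃ f ∈ G.edgeSet, f ∉ S ∧ f ≠ s(x, u) ∧ NoCommonGeodesic G s(x, u) f := by
  have hxu : G.Adj x u := deleteEdges_le _ h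
  obtain ⟨c, d, hcd, hadj, hne⟩ := exists_edge_ne_of_walk (edgeDiff G x u) p (by
    simp only [edgeDiff, dist_self, dist_eq_one_iff_adj.2 hxu]
    push_cast
    omega)
  rw [deleteEdges_adj] at hadj
  have hne' : s(c, d) ≠ s(x, u) := by
    intro hh
    rw [hh] at hcd
    exact hp (p.fst_mem_support_of_mem_edges hcd)
  exact ⟨s(c, d), hadj.1, hadj.2, hne',
    noCommonGeodesic_of_edgeDiff_ne hG hxu hadj.1 hne'.symm hne⟩

/-! ### Merging colors -/

/-- The color of an edge is its representative under `r`, and the colors in `S` become free. The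
geodesic may depend on the two vertices, so merged edges are allowed to share other geodesics. -/
theorem src_add_card_le [Finite V] (r : Sym2 V → Sym2 V) (S : Finset (Sym2 V))
    (hS : ∀ e ∈ S, e ∈ G.edgeSet) (hr : ∀ e ∈ G.edgeSet, r e ∈ G.edgeSet ∧ r e ∉ S)
    (hgeo : ∀ x y, ∃ p : G.Walk x y, p.length = G.dist x y ∧
      ∀ e ∈ p.edges, ∀ f ∈ p.edges, r e = r f → e = f) :
    src G + S.card ≤ G.edgeSet.ncard := by
  set T : Set (Sym2 V) := G.edgeSet \ S with hT
  have hcard : T.ncard + S.card = G.edgeSet.ncard := by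
    rw [← Set.ncard_coe_finset S]
    exact Set.ncard_sdiff_add_ncard_of_subset hS
  have hle : src G ≤ T.ncard := by
    have φ : T ≃ Fin T.ncard := by
      rw [← Nat.card_coe_set_eq]
      exact Finite.equivFin T
    refine Nat.sInf_le ⟨fun e => φ ⟨r e, hr e e.2⟩, fun x y => ?_⟩
    obtain ⟨p, hp, hinj⟩ := hgeo x y
    refine ⟨p, p.isPath_of_length_eq_dist hp, hp, fun e f he hf h => ?_⟩
    exact Subtype.ext (hinj e he f hf (congrArg Subtype.val (φ.injective h)))
  omega

theorem src_add_three_le [Finite V] {e₁ e₂ e₃ f₁ f₂ f₃ : Sym2 V}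
    (hE : ∀ e ∈ [e₁, e₂, e₃, f₁, f₂, f₃], e ∈ G.edgeSet)
    (hne : [e₁, e₂, e₃, f₁, f₂, f₃].Nodup)
    (hgeo : ∀ x y, ∃ p : G.Walk x y, p.length = G.dist x y ∧
      (e₁ ∈ p.edges → f₁ ∉ p.edges) ∧ (e₂ ∈ p.edges → f₂ ∉ p.edges) ∧
      (e₃ ∈ p.edges → f₃ ∉ p.edges)) :
    src G + 3 ≤ G.edgeSet.ncard := by
  classical
  simp only [List.nodup_cons, List.mem_cons, List.not_mem_nil, not_or, or_false, and_true,
    not_false_eq_true, List.nodup_nil] at hE hne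
  have h := src_add_card_le (G := G)
    (fun e => if e = f₁ then e₁ else if e = f₂ then e₂ else if e = f₃ then e₃ else e)
    {f₁, f₂, f₃} (by grind) (by grind) (fun x y => by
      obtain ⟨p, hp, h₁, h₂, h₃⟩ := hgeo x y
      exact ⟨p, hp, by grind⟩)
  rwa [Finset.card_eq_three.2 ⟨f₁, f₂, f₃, by grind, by grind, by grind, rfl⟩] at h

theorem src_add_three_le_of_noCommonGeodesic [Finite V] (hG : G.Connected)
    {e₁ e₂ e₃ f₁ f₂ f₃ : Sym2 V}
    (hE : ∀ e ∈ [e₁, e₂, e₃, f₁, f₂, f₃], e ∈ G.edgeSet)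
    (hne : [e₁, e₂, e₃, f₁, f₂, f₃].Nodup)
    (h₁ : NoCommonGeodesic G e₁ f₁) (h₂ : NoCommonGeodesic G e₂ f₂)
    (h₃ : NoCommonGeodesic G e₃ f₃) :
    src G + 3 ≤ G.edgeSet.ncard :=
  src_add_three_le hE hne fun x y => by
    obtain ⟨p, hp⟩ := hG.exists_walk_length_eq_dist x y
    exact ⟨p, hp, h₁ x y p hp, h₂ x y p hp, h₃ x y p hp⟩

theorem src_add_two_le_of_noCommonGeodesic [Finite V] (hG : G.Connected)
    {e₁ e₂ f₁ f₂ : Sym2 V} (hE : ∀ e ∈ [e₁, e₂, f₁, f₂], e ∈ G.edgeSet)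
    (hne : [e₁, e₂, f₁, f₂].Nodup)
    (h₁ : NoCommonGeodesic G e₁ f₁) (h₂ : NoCommonGeodesic G e₂ f₂) :
    src G + 2 ≤ G.edgeSet.ncard := by
  classical
  simp only [List.nodup_cons, List.mem_cons, List.not_mem_nil, not_or, or_false, and_true,
    not_false_eq_true, List.nodup_nil] at hE hne
  have h := src_add_card_le (G := G)
    (fun e => if e = f₁ then e₁ else if e = f₂ then e₂ else e)
    {f₁, f₂} (by grind) (by grind) (fun x y => by
      obtain ⟨p, hp⟩ := hG.exists_walk_length_eq_dist x y
      have := h₁ x y p hp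
      have := h₂ x y p hp
      exact ⟨p, hp, by grind⟩)
  rwa [Finset.card_pair (by grind)] at h

theorem noCommonGeodesic_of_triangle (hG : G.Connected) {a b c : V} (hab : G.Adj a b)
    (hbc : G.Adj b c) (hac : G.Adj a c) : NoCommonGeodesic G s(a, b) s(b, c) := by
  refine noCommonGeodesic_of_dist hG hab hbc ?_ ?_
  · have := hac.ne
    have := hab.ne
    grind
  · rw [dist_eq_one_iff_adj.2 hab, dist_eq_one_iff_adj.2 hbc, dist_eq_one_iff_adj.2 hac,
      dist_self]
    decide

/-- The three edges exclude one another on geodesics, so a single color serves all of them. -/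
theorem src_add_two_le_of_triangle [Finite V] (hG : G.Connected) {a b c : V} (hab : G.Adj a b)
    (hbc : G.Adj b c) (hac : G.Adj a c) : src G + 2 ≤ G.edgeSet.ncard := by
  classical
  have h₁ := noCommonGeodesic_of_triangle hG hab hbc hac
  have h₂ := noCommonGeodesic_of_triangle hG hbc hac.symm hab.symm
  have h₃ := noCommonGeodesic_of_triangle hG hac.symm hab hbc.symm
  have := hab.ne
  have := hac.ne
  have := hbc.ne
  have n₁ : s(a, b) ≠ s(b, c) := by grind
  have n₂ : s(b, c) ≠ s(c, a) := by grind
  have n₃ : s(c, a) ≠ s(a, b) := by grind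
  have m₁ : s(a, b) ∈ G.edgeSet := hab
  have m₂ : s(b, c) ∈ G.edgeSet := hbc
  have m₃ : s(c, a) ∈ G.edgeSet := hac.symm
  have h := src_add_card_le (G := G)
    (fun e => if e = s(a, b) then s(c, a) else if e = s(b, c) then s(c, a) else e)
    {s(a, b), s(b, c)} (by grind) (by grind) (fun x y => by
      obtain ⟨p, hp⟩ := hG.exists_walk_length_eq_dist x y
      have := h₁ x y p hp
      have := h₂ x y p hp
      have := h₃ x y p hp
      refine ⟨p, hp, ?_⟩
      generalize s(a, b) = e₁ at *
      generalize s(b, c) = e₂ at *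
      generalize s(c, a) = e₃ at *
      grind)
  rwa [Finset.card_pair n₁] at h

theorem src_add_three_le_of_triangle [Finite V] (hG : G.Connected) {a b c : V} (hab : G.Adj a b)
    (hbc : G.Adj b c) (hac : G.Adj a c) {e f : Sym2 V} (he : e ∈ G.edgeSet) (hf : f ∈ G.edgeSet)
    (heS : e ∉ ({s(a, b), s(b, c), s(c, a)} : Set (Sym2 V)))
    (hfS : f ∉ ({s(a, b), s(b, c), s(c, a)} : Set (Sym2 V)))
    (hne : f ≠ e) (hef : NoCommonGeodesic G e f) :
    src G + 3 ≤ G.edgeSet.ncard := by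
  classical
  have h₁ := noCommonGeodesic_of_triangle hG hab hbc hac
  have h₂ := noCommonGeodesic_of_triangle hG hbc hac.symm hab.symm
  have h₃ := noCommonGeodesic_of_triangle hG hac.symm hab hbc.symm
  have := hab.ne
  have := hac.ne
  have := hbc.ne
  have n₁ : s(a, b) ≠ s(b, c) := by grind
  have n₂ : s(b, c) ≠ s(c, a) := by grind
  have n₃ : s(c, a) ≠ s(a, b) := by grind
  have m₁ : s(a, b) ∈ G.edgeSet := hab
  have m₂ : s(b, c) ∈ G.edgeSet := hbc
  have m₃ : s(c, a) ∈ G.edgeSet := hac.symm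
  simp only [Set.mem_insert_iff, Set.mem_singleton_iff, not_or] at heS hfS
  generalize s(a, b) = e₁ at *
  generalize s(b, c) = e₂ at *
  generalize s(c, a) = e₃ at *
  have h := src_add_card_le (G := G)
    (fun x => if x = e₁ then e₃ else if x = e₂ then e₃ else if x = f then e else x)
    {e₁, e₂, f} (by grind) (by grind) (fun x y => by
      obtain ⟨p, hp⟩ := hG.exists_walk_length_eq_dist x y
      have := h₁ x y p hp
      have := h₂ x y p hp
      have := h₃ x y p hp
      have := hef x y p hp
      exact ⟨p, hp, by grind⟩)
  rwa [Finset.card_eq_three.2 ⟨e₁, e₂, f, by grind, by grind, by grind, rfl⟩] at h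

/-! ### Local configurations that save three colors -/

theorem dist_eq_one {a b : V} (h : G.Adj a b) : G.dist a b = 1 := dist_eq_one_iff_adj.2 h

theorem notMem_edges_left {x y a b : V} {p : G.Walk x y} (h : a ∉ p.support) :
    s(a, b) ∉ p.edges :=
  fun h' => h (p.fst_mem_support_of_mem_edges h')

theorem notMem_edges_right {x y a b : V} {p : G.Walk x y} (h : b ∉ p.support) :
    s(a, b) ∉ p.edges :=
  fun h' => h (p.snd_mem_support_of_mem_edges h')

/-- Chords are allowed. A closed walk of four unit steps on the line must have two opposite corners
at the same point, so the four distinct vertices cannot lie on one geodesic. -/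
theorem noCommonGeodesic_of_four_cycle (hG : G.Connected) {a b c d : V} (hab : G.Adj a b)
    (hbc : G.Adj b c) (hcd : G.Adj c d) (hda : G.Adj d a) (hac : a ≠ c) (hbd : b ≠ d) :
    NoCommonGeodesic G s(a, b) s(c, d) := by
  intro x y p hp h₁ h₂
  obtain ⟨φ, hφ⟩ := exists_potential hG hp
  have ha := p.fst_mem_support_of_mem_edges h₁
  have hb := p.snd_mem_support_of_mem_edges h₁
  have hc := p.fst_mem_support_of_mem_edges h₂
  have hd := p.snd_mem_support_of_mem_edges h₂
  have h₃ := hφ a ha b hb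
  have h₄ := hφ b hb c hc
  have h₅ := hφ c hc d hd
  have h₆ := hφ d hd a ha
  have h₇ := hφ a ha c hc
  have h₈ := hφ b hb d hd
  rw [dist_eq_one hab] at h₃
  rw [dist_eq_one hbc] at h₄
  rw [dist_eq_one hcd] at h₅
  rw [dist_eq_one hda] at h₆
  have := hG.pos_dist_of_ne hac
  have := hG.pos_dist_of_ne hbd
  omega

/-- Two nonadjacent vertices of a four-cycle exclude each other on a geodesic through the other
two vertices. -/
theorem notMem_support_of_four_cycle (hG : G.Connected) {a b c d : V} (hab : G.Adj a b)
    (hbc : G.Adj b c) (hcd : G.Adj c d) (hda : G.Adj d a) (hac : a ≠ c) (hbd : b ≠ d)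
    {x y : V} {p : G.Walk x y} (hp : p.length = G.dist x y) (ha : a ∈ p.support)
    (hd : d ∈ p.support) (hc : c ∈ p.support) : b ∉ p.support := by
  intro hb
  obtain ⟨φ, hφ⟩ := exists_potential hG hp
  have h₃ := hφ a ha b hb
  have h₄ := hφ b hb c hc
  have h₅ := hφ c hc d hd
  have h₆ := hφ d hd a ha
  have h₇ := hφ a ha c hc
  have h₈ := hφ b hb d hd
  rw [dist_eq_one hab] at h₃
  rw [dist_eq_one hbc] at h₄
  rw [dist_eq_one hcd] at h₅
  rw [dist_eq_one hda] at h₆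
  have := hG.pos_dist_of_ne hac
  have := hG.pos_dist_of_ne hbd
  omega

/-- A geodesic through consecutive vertices `a`, `b`, `c` of a four-cycle can be changed into a
geodesic avoiding `b`. -/
theorem exists_geodesic_avoiding (hG : G.Connected) {a b c d : V} (hab : G.Adj a b)
    (hbc : G.Adj b c) (hcd : G.Adj c d) (hda : G.Adj d a) (hac : a ≠ c) (hbd : b ≠ d)
    {x y : V} {p : G.Walk x y} (hp : p.length = G.dist x y) (ha : a ∈ p.support)
    (hb : b ∈ p.support) (hc : c ∈ p.support) :
    ∃ q : G.Walk x y, q.length = G.dist x y ∧ b ∉ q.support ∧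
      a ∈ q.support ∧ d ∈ q.support ∧ c ∈ q.support := by
  obtain ⟨φ, hφ⟩ := exists_potential hG hp
  have h₃ := hφ a ha b hb
  have h₄ := hφ b hb c hc
  have h₇ := hφ a ha c hc
  rw [dist_eq_one hab] at h₃
  rw [dist_eq_one hbc] at h₄
  have := hG.pos_dist_of_ne hac
  obtain ⟨q, hq, h₁, h₂, h₃⟩ := exists_geodesic_through hG hp ha hc (z := d) (by
    rw [dist_eq_one hda.symm, dist_eq_one hcd.symm]
    omega)
  exact ⟨q, hq, notMem_support_of_four_cycle hG hab hbc hcd hda hac hbd hq h₁ h₂ h₃, h₁, h₂, h₃⟩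

/-- Merge ab with cd, wa with bc, and zb with da. A geodesic containing wa and bc passes through a,
b, c and can be rerouted through d; it then avoids b, hence an edge of each pair. The pair zb, da is
treated alike, with a avoided. -/
theorem src_add_three_le_of_adjacent_attachments [Finite V] (hG : G.Connected) {a b c d w z : V}
    (hab : G.Adj a b) (hbc : G.Adj b c) (hcd : G.Adj c d) (hda : G.Adj d a) (hac : a ≠ c)
    (hbd : b ≠ d) (hw : G.Adj w a) (hz : G.Adj z b) (hwb : w ≠ b) (hwc : w ≠ c) (hwd : w ≠ d)
    (hza : z ≠ a) (hzc : z ≠ c) (hzd : z ≠ d) : src G + 3 ≤ G.edgeSet.ncard := by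
  have n₁ := hab.ne
  have n₂ := hbc.ne
  have n₃ := hcd.ne
  have n₄ := hda.ne
  have n₅ := hw.ne
  have n₆ := hz.ne
  refine src_add_three_le (e₁ := s(a, b)) (f₁ := s(c, d)) (e₂ := s(w, a)) (f₂ := s(b, c))
    (e₃ := s(z, b)) (f₃ := s(d, a)) ?_ ?_ ?_
  · simp [hab, hbc, hcd, hda, hw, hz]
  · simp only [List.nodup_cons, List.mem_cons, List.not_mem_nil, Sym2.eq_iff]
    grind
  · intro x y
    obtain ⟨p, hp⟩ := hG.exists_walk_length_eq_dist x y
    by_cases h₂ : s(w, a) ∈ p.edges ∧ s(b, c) ∈ p.edges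
    · obtain ⟨q, hq, hbq, -⟩ := exists_geodesic_avoiding hG hab hbc hcd hda hac hbd hp
        (p.snd_mem_support_of_mem_edges h₂.1) (p.fst_mem_support_of_mem_edges h₂.2)
        (p.snd_mem_support_of_mem_edges h₂.2)
      exact ⟨q, hq, fun h => absurd h (notMem_edges_right hbq), fun _ => notMem_edges_left hbq,
        fun h => absurd h (notMem_edges_right hbq)⟩
    by_cases h₃ : s(z, b) ∈ p.edges ∧ s(d, a) ∈ p.edges
    · obtain ⟨q, hq, haq, -⟩ := exists_geodesic_avoiding hG hab.symm hda.symm hcd.symm hbc.symm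
        hbd hac hp (p.snd_mem_support_of_mem_edges h₃.1) (p.snd_mem_support_of_mem_edges h₃.2)
        (p.fst_mem_support_of_mem_edges h₃.2)
      exact ⟨q, hq, fun h => absurd h (notMem_edges_left haq),
        fun h => absurd h (notMem_edges_right haq), fun _ => notMem_edges_right haq⟩
    exact ⟨p, hp, noCommonGeodesic_of_four_cycle hG hab hbc hcd hda hac hbd x y p hp,
      fun h h' => h₂ ⟨h, h'⟩, fun h h' => h₃ ⟨h, h'⟩⟩

/-- A geodesic through `u`, `d`, `c` in this order avoids the other neighbor `b` of `c` and the
vertices which have the same distances as `u` to `d` and `c`. -/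
theorem notMem_support_of_dist_eq (hG : G.Connected) {b c d u v : V} {n : ℕ} (hbc : G.Adj b c)
    (hcd : G.Adj c d) (hbd : 0 < G.dist b d) (hbd' : G.dist b d ≤ 2) (huv : 0 < G.dist u v)
    (hub : G.dist u b = n + 1) (hud : G.dist u d = n + 1) (huc : G.dist u c = n + 2)
    (hvd : G.dist v d = n + 1) (hvc : G.dist v c = n + 2) {x y : V} {q : G.Walk x y}
    (hq : q.length = G.dist x y) (hu : u ∈ q.support) (hd : d ∈ q.support)
    (hc : c ∈ q.support) : b ∉ q.support ∧ v ∉ q.support := by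
  obtain ⟨φ, hφ⟩ := exists_potential hG hq
  have e₁ := hφ u hu d hd
  have e₂ := hφ u hu c hc
  have e₅ := hφ c hc d hd
  rw [dist_eq_one hcd] at e₅
  have key : (φ d = φ u + (n + 1) ∧ φ c = φ u + (n + 2)) ∨
      (φ u = φ d + (n + 1) ∧ φ u = φ c + (n + 2)) := by omega
  clear e₁ e₂ e₅
  refine ⟨fun hb => ?_, fun hv => ?_⟩
  · have e₃ := hφ u hu b hb
    have e₄ := hφ b hb c hc
    have e₆ := hφ b hb d hd
    rw [dist_eq_one hbc] at e₄
    rcases key with ⟨k₁, k₂⟩ | ⟨k₁, k₂⟩ <;> omega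
  · have e₃ := hφ v hv d hd
    have e₄ := hφ v hv c hc
    have e₆ := hφ u hu v hv
    rcases key with ⟨k₁, k₂⟩ | ⟨k₁, k₂⟩ <;> omega

/-- On a line, b and d would both be the neighbor of c on the side of u, hence the same point. -/
theorem notMem_support_of_equidistant (hG : G.Connected) {b c d u : V} {n : ℕ} (hbc : G.Adj b c)
    (hcd : G.Adj c d) (hbd : 0 < G.dist b d) (hub : G.dist u b = n + 1)
    (hud : G.dist u d = n + 1) (huc : G.dist u c = n + 2) {x y : V} {q : G.Walk x y}
    (hq : q.length = G.dist x y) (hb : b ∈ q.support) (hc : c ∈ q.support)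
    (hd : d ∈ q.support) : u ∉ q.support := by
  intro hu
  obtain ⟨φ, hφ⟩ := exists_potential hG hq
  have e₁ := hφ u hu b hb
  have e₂ := hφ u hu c hc
  have e₃ := hφ u hu d hd
  have e₄ := hφ b hb c hc
  have e₅ := hφ c hc d hd
  have e₆ := hφ b hb d hd
  rw [dist_eq_one hbc] at e₄
  rw [dist_eq_one hcd] at e₅
  have key : φ b = φ d := by omega
  omega

/-- The distances are those of two vertices at depth n in a tree attached at a. Merge ab with da, bc
with zz₁, and cd with zz₂. Each pair may share a geodesic, but taking the other side of the
four-cycle separates it without bringing another pair together. -/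
theorem src_add_three_le_of_branching [Finite V] (hG : G.Connected) {a b c d z z₁ z₂ : V} {n : ℕ}
    (hab : G.Adj a b) (hbc : G.Adj b c) (hcd : G.Adj c d) (hda : G.Adj d a) (hac : a ≠ c)
    (hbd : b ≠ d) (hz₁ : G.Adj z z₁) (hz₂ : G.Adj z z₂) (hz : z₁ ≠ z₂) (hn : n ≠ 0)
    (h₁b : G.dist z₁ b = n + 1) (h₁d : G.dist z₁ d = n + 1) (h₁c : G.dist z₁ c = n + 2)
    (h₂b : G.dist z₂ b = n + 1) (h₂d : G.dist z₂ d = n + 1) (h₂c : G.dist z₂ c = n + 2) :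
    src G + 3 ≤ G.edgeSet.ncard := by
  have n₁ := hab.ne
  have n₂ := hbc.ne
  have n₃ := hcd.ne
  have n₄ := hda.ne
  have hout : ∀ u, G.dist u b = n + 1 → G.dist u d = n + 1 → G.dist u c = n + 2 →
      u ≠ a ∧ u ≠ b ∧ u ≠ c ∧ u ≠ d := by
    intro u h₁ h₂ h₃
    refine ⟨?_, ?_, ?_, ?_⟩ <;> rintro rfl
    -- Here `hn` matters: at depth 0 the vertex could be a itself.
    · rw [dist_eq_one hab] at h₁; omega
    all_goals rw [dist_self] at *; omega
  obtain ⟨a₁, b₁, c₁, d₁⟩ := hout z₁ h₁b h₁d h₁c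
  obtain ⟨a₂, b₂, c₂, d₂⟩ := hout z₂ h₂b h₂d h₂c
  have hbd0 := hG.pos_dist_of_ne hbd
  have hbd2 : G.dist b d ≤ 2 := by
    have := hG.dist_triangle (u := b) (v := c) (w := d)
    rw [dist_eq_one hbc, dist_eq_one hcd] at this
    exact this
  have hz0 := hG.pos_dist_of_ne hz
  refine src_add_three_le (e₁ := s(a, b)) (f₁ := s(d, a)) (e₂ := s(b, c)) (f₂ := s(z, z₁))
    (e₃ := s(c, d)) (f₃ := s(z, z₂)) ?_ ?_ ?_
  · simp [hab, hbc, hcd, hda, hz₁, hz₂]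
  · simp only [List.nodup_cons, List.mem_cons, List.not_mem_nil, Sym2.eq_iff]
    grind
  · intro x y
    obtain ⟨p, hp⟩ := hG.exists_walk_length_eq_dist x y
    by_cases h₁ : s(a, b) ∈ p.edges ∧ s(d, a) ∈ p.edges
    · obtain ⟨q, hq, haq, hb, hc, hd⟩ := exists_geodesic_avoiding hG hab.symm hda.symm hcd.symm
        hbc.symm hbd hac hp (p.snd_mem_support_of_mem_edges h₁.1)
        (p.fst_mem_support_of_mem_edges h₁.1) (p.fst_mem_support_of_mem_edges h₁.2)
      exact ⟨q, hq, fun h => absurd h (notMem_edges_left haq),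
        fun _ => notMem_edges_right (notMem_support_of_equidistant hG hbc hcd hbd0 h₁b h₁d h₁c hq
          hb hc hd),
        fun _ => notMem_edges_right (notMem_support_of_equidistant hG hbc hcd hbd0 h₂b h₂d h₂c hq
          hb hc hd)⟩
    by_cases h₂ : s(b, c) ∈ p.edges ∧ s(z, z₁) ∈ p.edges
    · obtain ⟨q, hq, hu, hd, hc⟩ := exists_geodesic_through hG hp
        (p.snd_mem_support_of_mem_edges h₂.2) (p.snd_mem_support_of_mem_edges h₂.1) (z := d)
        (by rw [dist_eq_one hcd.symm]; omega)
      obtain ⟨k₁, k₂⟩ := notMem_support_of_dist_eq hG hbc hcd hbd0 hbd2 hz0 h₁b h₁d h₁c h₂d h₂c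
        hq hu hd hc
      exact ⟨q, hq, fun h => absurd h (notMem_edges_right k₁),
        fun h => absurd h (notMem_edges_left k₁), fun _ => notMem_edges_right k₂⟩
    by_cases h₃ : s(c, d) ∈ p.edges ∧ s(z, z₂) ∈ p.edges
    · obtain ⟨q, hq, hu, hb, hc⟩ := exists_geodesic_through hG hp
        (p.snd_mem_support_of_mem_edges h₃.2) (p.fst_mem_support_of_mem_edges h₃.1) (z := b)
        (by rw [dist_eq_one hbc]; omega)
      rw [dist_comm] at hz0 hbd0 hbd2
      obtain ⟨k₁, k₂⟩ := notMem_support_of_dist_eq hG hcd.symm hbc.symm hbd0 hbd2 hz0 h₂d h₂b h₂c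
        h₁b h₁c hq hu hb hc
      exact ⟨q, hq, fun _ => notMem_edges_left k₁, fun _ => notMem_edges_right k₂,
        fun h => absurd h (notMem_edges_right k₁)⟩
    exact ⟨p, hp, fun h h' => h₁ ⟨h, h'⟩, fun h h' => h₂ ⟨h, h'⟩, fun h h' => h₃ ⟨h, h'⟩⟩

/-- The six edges of a K_{2,3} split into three pairs, each opposite in one of its four-cycles. -/
theorem src_add_three_le_of_three_common_neighbors [Finite V] (hG : G.Connected)
    {x y a b c : V} (hxy : x ≠ y) (hab : a ≠ b) (hbc : b ≠ c) (hac : a ≠ c) (hxa : G.Adj x a)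
    (hxb : G.Adj x b) (hxc : G.Adj x c) (hya : G.Adj y a) (hyb : G.Adj y b) (hyc : G.Adj y c) :
    src G + 3 ≤ G.edgeSet.ncard := by
  have n₁ := hxa.ne
  have n₂ := hxb.ne
  have n₃ := hxc.ne
  have n₄ := hya.ne
  have n₅ := hyb.ne
  have n₆ := hyc.ne
  refine src_add_three_le_of_noCommonGeodesic hG (e₁ := s(x, a)) (f₁ := s(y, b))
    (e₂ := s(x, b)) (f₂ := s(y, c)) (e₃ := s(x, c)) (f₃ := s(y, a)) ?_ ?_
    (noCommonGeodesic_of_four_cycle hG hxa hya.symm hyb hxb.symm hxy hab)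
    (noCommonGeodesic_of_four_cycle hG hxb hyb.symm hyc hxc.symm hxy hbc)
    (noCommonGeodesic_of_four_cycle hG hxc hyc.symm hya hxa.symm hxy hac.symm)
  · simp [hxa, hxb, hxc, hya, hyb, hyc]
  · simp only [List.nodup_cons, List.mem_cons, List.not_mem_nil, Sym2.eq_iff]
    grind

theorem src_add_three_le_of_four_cycle [Finite V] (hG : G.Connected) {a b c d : V}
    (hab : G.Adj a b) (hbc : G.Adj b c) (hcd : G.Adj c d) (hda : G.Adj d a) (hac : a ≠ c)
    (hbd : b ≠ d) {e f : Sym2 V} (he : e ∈ G.edgeSet) (hf : f ∈ G.edgeSet)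
    (heS : e ∉ ({s(a, b), s(b, c), s(c, d), s(d, a)} : Set (Sym2 V)))
    (hfS : f ∉ ({s(a, b), s(b, c), s(c, d), s(d, a)} : Set (Sym2 V)))
    (hne : f ≠ e) (hef : NoCommonGeodesic G e f) :
    src G + 3 ≤ G.edgeSet.ncard := by
  have n₁ := hab.ne
  have n₂ := hbc.ne
  have n₃ := hcd.ne
  have n₄ := hda.ne
  refine src_add_three_le_of_noCommonGeodesic hG (e₁ := s(a, b)) (f₁ := s(c, d))
    (e₂ := s(b, c)) (f₂ := s(d, a)) (e₃ := e) (f₃ := f) ?_ ?_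
    (noCommonGeodesic_of_four_cycle hG hab hbc hcd hda hac hbd)
    (noCommonGeodesic_of_four_cycle hG hbc hcd hda hab hbd hac.symm) hef
  · simp [hab, hbc, hcd, hda, he, hf]
  · simp only [Set.mem_insert_iff, Set.mem_singleton_iff, not_or] at heS hfS
    have m₁ : s(a, b) ≠ s(b, c) := by grind
    have m₂ : s(a, b) ≠ s(c, d) := by grind
    have m₃ : s(a, b) ≠ s(d, a) := by grind
    have m₄ : s(b, c) ≠ s(c, d) := by grind
    have m₅ : s(b, c) ≠ s(d, a) := by grind
    have m₆ : s(c, d) ≠ s(d, a) := by grind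
    simp only [List.nodup_cons, List.mem_cons, List.not_mem_nil]
    generalize s(a, b) = e₁ at *
    generalize s(b, c) = e₂ at *
    generalize s(c, d) = e₃ at *
    generalize s(d, a) = e₄ at *
    grind

/-- Each attached edge is merged with the triangle edge opposite its root, whose ends are
equidistant from the root. -/
theorem src_add_three_le_of_triangle_attachments [Finite V] (hG : G.Connected)
    {a b c w₁ w₂ w₃ : V} (hab : G.Adj a b) (hbc : G.Adj b c) (hac : G.Adj a c)
    (h₁ : G.Adj w₁ a) (h₂ : G.Adj w₂ b) (h₃ : G.Adj w₃ c) (h₁b : w₁ ≠ b) (h₁c : w₁ ≠ c)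
    (h₂a : w₂ ≠ a) (h₂c : w₂ ≠ c) (h₃a : w₃ ≠ a) (h₃b : w₃ ≠ b) :
    src G + 3 ≤ G.edgeSet.ncard := by
  have n₁ := hab.ne
  have n₂ := hbc.ne
  have n₃ := hac.ne
  have n₄ := h₁.ne
  have n₅ := h₂.ne
  have n₆ := h₃.ne
  refine src_add_three_le_of_noCommonGeodesic hG (e₁ := s(w₁, a)) (f₁ := s(b, c))
    (e₂ := s(w₂, b)) (f₂ := s(a, c)) (e₃ := s(w₃, c)) (f₃ := s(a, b)) ?_ ?_
    (noCommonGeodesic_of_equidistant hG hbc (by rw [dist_eq_one hab, dist_eq_one hac]))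
    (noCommonGeodesic_of_equidistant hG hac (by rw [dist_eq_one hab.symm, dist_eq_one hbc]))
    (noCommonGeodesic_of_equidistant hG hab
      (by rw [dist_eq_one hac.symm, dist_eq_one hbc.symm]))
  · simp [hab, hbc, hac, h₁, h₂, h₃]
  · simp only [List.nodup_cons, List.mem_cons, List.not_mem_nil, Sym2.eq_iff]
    grind

/-- The pendant edge wa uses up the edge cd opposite a, and the other four cycle edges form two
related pairs. -/
theorem src_add_three_le_of_five_cycle [Finite V] (hG : G.Connected) {a b c d e w : V}
    (hab : G.Adj a b) (hbc : G.Adj b c) (hcd : G.Adj c d) (hde : G.Adj d e) (hea : G.Adj e a)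
    (hac : G.dist a c = 2) (hbd : G.dist b d = 2) (hce : G.dist c e = 2) (hda : G.dist d a = 2)
    (heb : G.dist e b = 2) (hw : G.Adj w a) (hwb : w ≠ b) (hwc : w ≠ c) (hwd : w ≠ d)
    (hwe : w ≠ e) : src G + 3 ≤ G.edgeSet.ncard := by
  have n₁ := hab.ne
  have n₂ := hbc.ne
  have n₃ := hcd.ne
  have n₄ := hde.ne
  have n₅ := hea.ne
  have n₆ := hw.ne
  have hne : ∀ u v, G.dist u v = 2 → u ≠ v := by
    rintro u v h rfl
    rw [dist_self] at h
    omega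
  have m₁ := hne _ _ hac
  have m₂ := hne _ _ hbd
  have m₃ := hne _ _ hce
  have m₄ := hne _ _ hda
  have m₅ := hne _ _ heb
  refine src_add_three_le_of_noCommonGeodesic hG (e₁ := s(w, a)) (f₁ := s(c, d))
    (e₂ := s(a, b)) (f₂ := s(d, e)) (e₃ := s(b, c)) (f₃ := s(e, a)) ?_ ?_
    (noCommonGeodesic_of_equidistant hG hcd (by rw [hac, dist_comm, hda]))
    (noCommonGeodesic_of_dist hG hab hde (by rw [ne_eq, Sym2.eq_iff]; grind) ?_)
    (noCommonGeodesic_of_dist hG hbc hea (by rw [ne_eq, Sym2.eq_iff]; grind) ?_)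
  · simp [hab, hbc, hcd, hde, hea, hw]
  · simp only [List.nodup_cons, List.mem_cons, List.not_mem_nil, Sym2.eq_iff]
    grind
  · rw [dist_comm (u := a) (v := d), dist_comm (u := b) (v := e), hda, heb, hbd,
      dist_eq_one hea.symm]
    decide
  · rw [dist_comm (u := b) (v := e), dist_comm (u := c) (v := a), heb, hac, hce,
      dist_eq_one hab.symm]
    decide

/-! ### Lower bounds from acyclic subgraphs -/

/-- In a forest, a neighbor of the start x that lies on the path must be its second vertex;
otherwise the path can be prolonged to it. -/
theorem exists_path_extending {H : SimpleGraph V} (hH : H.IsAcyclic) {x y z : V}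
    {p : H.Walk x y} (hp : p.IsPath) (h : H.Adj z x) :
    ∃ (w : V) (q : H.Walk w y), (w = x ∨ w = z) ∧ q.IsPath ∧ s(z, x) ∈ q.edges ∧
      p.edges ⊆ q.edges := by
  by_cases hz : z ∈ p.support
  · refine ⟨x, p, Or.inl rfl, hp, ?_, List.Subset.refl _⟩
    have hs := hH.eq_snd_of_adj_start hp h.symm hz
    have hnil : ¬ p.Nil := fun hn => by
      rw [Walk.nil_iff_support_eq.1 hn, List.mem_singleton] at hz
      exact h.ne hz
    rw [Sym2.eq_swap, hs]
    exact p.mk_start_snd_mem_edges hnil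
  · exact ⟨z, Walk.cons h p, Or.inr rfl, hp.cons hz, by simp, by simp⟩

theorem exists_path_through_two_edges {H : SimpleGraph V} (hH : H.IsAcyclic) {a b c d : V}
    (hab : H.Adj a b) (hcd : H.Adj c d) (hr : H.Reachable a c) :
    ∃ (x y : V) (q : H.Walk x y), (x = a ∨ x = b) ∧ (y = c ∨ y = d) ∧ q.IsPath ∧
      s(a, b) ∈ q.edges ∧ s(c, d) ∈ q.edges := by
  obtain ⟨p, hp⟩ := hr.exists_isPath
  obtain ⟨x, q, hx, hq, he, -⟩ := exists_path_extending hH hp hab.symm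
  obtain ⟨y, r, hy, hr, hf, hqr⟩ := exists_path_extending hH hq.reverse hcd.symm
  refine ⟨x, y, r.reverse, hx, hy, hr.reverse, ?_, ?_⟩
  · rw [Walk.edges_reverse, List.mem_reverse]
    apply hqr
    rw [Walk.edges_reverse, List.mem_reverse, Sym2.eq_swap]
    exact he
  · rw [Walk.edges_reverse, List.mem_reverse, Sym2.eq_swap]
    exact hf

/-- Two edges of the forest lie on a path of it. A rainbow geodesic between the ends of this path
stays in the forest, hence is this path, so the edges have different colors. -/
theorem ncard_edgeSet_le_src [Finite V] (hG : G.Connected) {H : SimpleGraph V} (hle : H ≤ G)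
    (hH : H.IsAcyclic) (hgeo : ∀ x y, (∃ z, H.Adj x z) → (∃ z, H.Adj y z) →
      ∀ p : G.Walk x y, p.length = G.dist x y → ∀ e ∈ p.edges, e ∈ H.edgeSet) :
    H.edgeSet.ncard ≤ src G := by
  obtain ⟨col, hcol⟩ := exists_isStrongRainbow_src hG
  have hinj : Function.Injective
      (fun e : H.edgeSet => col ⟨e, edgeSet_mono hle e.2⟩) := by
    rintro ⟨e, he⟩ ⟨f, hf⟩ hef
    induction e using Sym2.inductionOn with | hf a b =>
    induction f using Sym2.inductionOn with | hf c d =>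
    have hab : H.Adj a b := he
    have hcd : H.Adj c d := hf
    obtain ⟨p, hp⟩ := hG.exists_walk_length_eq_dist a c
    have hr : H.Reachable a c := ⟨p.transfer H (hgeo a c ⟨b, hab⟩ ⟨d, hcd⟩ p hp)⟩
    obtain ⟨x, y, q, hx, hy, hq, heq, hfq⟩ := exists_path_through_two_edges hH hab hcd hr
    have hx' : ∃ z, H.Adj x z := by
      rcases hx with rfl | rfl
      exacts [⟨b, hab⟩, ⟨a, hab.symm⟩]
    have hy' : ∃ z, H.Adj y z := by
      rcases hy with rfl | rfl
      exacts [⟨d, hcd⟩, ⟨c, hcd.symm⟩]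
    obtain ⟨r, hr, hrl, hrain⟩ := hcol x y
    have hrH := hgeo x y hx' hy' r hrl
    have hqr : q = r.transfer H hrH := congrArg Subtype.val
      ((hH.subsingleton_path x y).elim ⟨q, hq⟩ ⟨r.transfer H hrH, hr.transfer hrH⟩)
    rw [hqr, Walk.edges_transfer] at heq hfq
    exact Subtype.ext (Subtype.mk.inj (hrain ⟨_, edgeSet_mono hle he⟩
      ⟨_, edgeSet_mono hle hf⟩ heq hfq hef))
  have := Nat.card_le_card_of_injective _ hinj
  rwa [Nat.card_coe_set_eq, Nat.card_fin] at this

theorem ncard_edgeSet_le_src_of_isTree [Finite V] (hG : G.IsTree) : G.edgeSet.ncard ≤ src G :=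
  ncard_edgeSet_le_src hG.connected le_rfl hG.isAcyclic
    fun _ _ _ _ p _ _ he => p.edges_subset_edgeSet he

theorem dist_le_src [Finite V] (hG : G.Connected) (x y : V) : G.dist x y ≤ src G := by
  obtain ⟨col, hcol⟩ := exists_isStrongRainbow_src hG
  obtain ⟨p, hp, hl, hrain⟩ := hcol x y
  have hinj : Function.Injective
      (fun e : {e // e ∈ p.edges} => col ⟨e, p.edges_subset_edgeSet e.2⟩) := by
    rintro ⟨e, he⟩ ⟨f, hf⟩ h
    exact Subtype.ext (Subtype.mk.inj (hrain ⟨e, p.edges_subset_edgeSet he⟩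
      ⟨f, p.edges_subset_edgeSet hf⟩ he hf h))
  classical
  have h := Nat.card_le_card_of_injective _ hinj
  rw [Nat.card_fin] at h
  have h₂ : Nat.card {e // e ∈ p.edges} = p.length := by
    rw [← p.length_edges, ← List.toFinset_card_of_nodup hp.isTrail.edges_nodup,
      Nat.card_congr (Equiv.subtypeEquivRight fun e => List.mem_toFinset.symm),
      Nat.card_eq_fintype_card, Fintype.card_coe]
  omega

/-! ### The five-cycle -/

theorem not_isAcyclic_of_iso_cycleGraph (φ : G ≃g cycleGraph 5) : ¬ G.IsAcyclic := by
  rw [isAcyclic_iff_free_cycleGraph]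
  intro h
  exact h 5 (by decide) ⟨φ.symm.toCopy⟩

theorem ncard_edgeSet_of_iso_cycleGraph (φ : G ≃g cycleGraph 5) : G.edgeSet.ncard = 5 := by
  rw [← Nat.card_coe_set_eq, Nat.card_congr φ.mapEdgeSet, Nat.card_eq_fintype_card]
  decide

/-- Vertices i and i + 2 have a unique geodesic, so consecutive edges differ in color; two colors
cannot alternate around an odd cycle. -/
theorem three_le_src_of_iso_cycleGraph [Finite V] (hG : G.Connected)
    (φ : G ≃g cycleGraph 5) : 3 ≤ src G := by
  obtain ⟨col, hcol⟩ := exists_isStrongRainbow_src hG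
  have hadj : ∀ i : Fin 5, G.Adj (φ.symm i) (φ.symm (i + 1)) := by
    intro i
    rw [φ.symm.map_adj_iff]
    revert i
    decide
  have key : ∀ i : Fin 5, col ⟨s(φ.symm i, φ.symm (i + 1)), hadj i⟩ ≠
      col ⟨s(φ.symm (i + 1), φ.symm (i + 1 + 1)), hadj (i + 1)⟩ := by
    intro i hc
    have hd : ¬ (cycleGraph 5).Adj i (i + 1 + 1) ∧ i ≠ i + 1 + 1 ∧
        ∀ j, (cycleGraph 5).Adj i j → (cycleGraph 5).Adj j (i + 1 + 1) → j = i + 1 := by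
      clear hc
      revert i
      decide
    obtain ⟨d₁, d₂, d₃⟩ := hd
    obtain ⟨p, -, hp, hrain⟩ := hcol (φ.symm i) (φ.symm (i + 1 + 1))
    have hle : p.length ≤ 2 := by
      rw [hp]
      exact dist_le (Walk.cons (hadj i) (Walk.cons (hadj (i + 1)) Walk.nil))
    have hmid : s(φ.symm i, φ.symm (i + 1)) ∈ p.edges ∧
        s(φ.symm (i + 1), φ.symm (i + 1 + 1)) ∈ p.edges := by
      clear hrain hp hc
      generalize hu : φ.symm i = u at *
      generalize hv : φ.symm (i + 1 + 1) = v at *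
      cases p with
      | nil => exact absurd (φ.symm.injective (hu.trans hv.symm)) d₂
      | @cons _ w _ h₁ p =>
        cases p with
        | nil =>
          rw [← hu, ← hv, φ.symm.map_adj_iff] at h₁
          exact absurd h₁ d₁
        | cons h₂ p =>
          cases p with
          | nil =>
            obtain ⟨j, rfl⟩ := φ.symm.surjective w
            rw [← hu, φ.symm.map_adj_iff] at h₁
            rw [← hv, φ.symm.map_adj_iff] at h₂
            obtain rfl := d₃ j h₁ h₂
            simp
          | cons _ p =>
            simp only [Walk.length_cons] at hle
            omega
    have := congrArg Subtype.val (hrain _ _ hmid.1 hmid.2 hc)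
    simp only [Sym2.eq_iff, EmbeddingLike.apply_eq_iff_eq] at this
    rcases this with ⟨h, -⟩ | ⟨h, -⟩
    · revert h
      clear * -
      revert i
      decide
    · exact d₂ h
  by_contra hlt
  have k₀ := key 0
  have k₁ := key 1
  have k₂ := key 2
  have k₃ := key 3
  have k₄ := key 4
  simp only [Fin.isValue, Fin.reduceAdd, ne_eq, ← Fin.val_inj] at k₀ k₁ k₂ k₃ k₄
  have b : ∀ i : Fin 5, (col ⟨s(φ.symm i, φ.symm (i + 1)), hadj i⟩ : ℕ) < 2 := fun i =>
    lt_of_lt_of_le (Fin.is_lt _) (by omega)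
  have b₀ := b 0
  have b₁ := b 1
  have b₂ := b 2
  have b₃ := b 3
  have b₄ := b 4
  simp only [Fin.isValue, Fin.reduceAdd] at b₀ b₁ b₂ b₃ b₄
  omega

/-! ### Shortest cycles -/

/-- A strictly shorter geodesic would form with `q` a cycle of length less than k. -/
theorem dist_eq_length_of_isPath (hG : G.Connected) {k : ℕ}
    (hk : ∀ (v : V) (D : G.Walk v v), D.IsCycle → k ≤ D.length) {x y : V} {q : G.Walk x y}
    (hq : q.IsPath) (hl : 2 * q.length ≤ k) : G.dist x y = q.length := by
  by_contra hne
  have hle := dist_le q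
  obtain ⟨p, hp, hpl⟩ := hG.exists_path_of_dist x y
  obtain ⟨w, -, -, D, hD, hDl⟩ := hp.exists_isCycle_length_le_add_of_ne hq (by
    rintro rfl
    exact hne hpl.symm)
  have := hk w D hD
  omega

theorem dist_eq_two (hG : G.Connected) {k : ℕ}
    (hk : ∀ (v : V) (D : G.Walk v v), D.IsCycle → k ≤ D.length) (hk4 : 4 ≤ k) {x y z : V}
    (hxy : G.Adj x y) (hyz : G.Adj y z) (hxz : x ≠ z) : G.dist x z = 2 :=
  dist_eq_length_of_isPath hG hk (q := Walk.cons hxy (Walk.cons hyz Walk.nil))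
    (by simp [Walk.isPath_def, hxy.ne, hyz.ne, hxz]) hk4

theorem dist_getVert_add (hG : G.Connected) {v : V} {C : G.Walk v v} (hC : C.IsCycle)
    (hk : ∀ (v : V) (D : G.Walk v v), D.IsCycle → C.length ≤ D.length) {i h : ℕ}
    (hi : i + h ≤ C.length) (hh : 2 * h ≤ C.length) :
    G.dist (C.getVert i) (C.getVert (i + h)) = h := by
  have h3 := hC.three_le_length
  have hpath : ((C.drop i).take h).IsPath := by
    -- A cycle becomes a path only after losing an edge: at its end if i = 0, at its start
    -- otherwise.
    rcases Nat.eq_zero_or_pos i with rfl | hpos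
    · have := hC.isPath_take (n := h) (by omega)
      rw [Walk.isPath_def, Walk.support_take] at this ⊢
      rwa [Walk.drop_support_eq_support_drop_min, Nat.zero_min, List.drop_zero]
    · exact (hC.isPath_drop hpos).take h
  have hlen : ((C.drop i).take h).length = h := by
    simp
    omega
  have := dist_eq_length_of_isPath hG hk hpath (by omega)
  rw [hlen] at this
  rwa [Walk.drop_getVert] at this

theorem dist_getVert_le {x y : V} (p : G.Walk x y) (i h : ℕ) :
    G.dist (p.getVert i) (p.getVert (i + h)) ≤ h := by
  have := dist_le ((p.drop i).take h)
  rw [← Walk.drop_getVert]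
  refine this.trans ?_
  simp

theorem cycle_edge_ne {v : V} {C : G.Walk v v} (hC : C.IsCycle) {i j : ℕ} (hij : i < j)
    (hj : j < C.length) :
    s(C.getVert i, C.getVert (i + 1)) ≠ s(C.getVert j, C.getVert (j + 1)) := by
  have h3 := hC.three_le_length
  have inj : ∀ m n, m < C.length → n < C.length → C.getVert m = C.getVert n → m = n :=
    fun m n hm hn h => hC.getVert_injOn' (by simp; omega) (by simp; omega) h
  intro h
  rcases Sym2.eq_iff.1 h with ⟨h₁, -⟩ | ⟨h₁, h₂⟩
  · have := inj _ _ (by omega) hj h₁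
    omega
  · have e := inj _ _ (by omega) hj h₂
    subst e
    rcases Nat.lt_or_ge (i + 1 + 1) C.length with hlt | hge
    · have := inj _ _ (by omega) hlt h₁
      omega
    · rw [show i + 1 + 1 = C.length by omega, C.getVert_length] at h₁
      have := inj _ _ (by omega) (by omega) (h₁.trans C.getVert_zero.symm)
      omega

/-- Let k be the length and h = ⌊k/2⌋. As the cycle is shortest, the corresponding ends are at
distance exactly h, with sum 2h. The crossed distances are at most h - 1 and k - h - 1 ≤ h, so their
sum is smaller. -/
theorem noCommonGeodesic_of_antipodal (hG : G.Connected) {v : V} {C : G.Walk v v}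
    (hC : C.IsCycle) (hk : ∀ (v : V) (D : G.Walk v v), D.IsCycle → C.length ≤ D.length) {i : ℕ}
    (h4 : 4 ≤ C.length) (hi : i + C.length / 2 + 1 ≤ C.length) :
    NoCommonGeodesic G s(C.getVert i, C.getVert (i + 1))
      s(C.getVert (i + C.length / 2), C.getVert (i + C.length / 2 + 1)) := by
  refine noCommonGeodesic_of_dist hG (C.adj_getVert_succ (by omega))
    (C.adj_getVert_succ (by omega)) (cycle_edge_ne hC (by omega) (by omega)) ?_
  have h₁ := dist_getVert_add hG hC hk (i := i) (h := C.length / 2) (by omega) (by omega)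
  have h₂ := dist_getVert_add hG hC hk (i := i + 1) (h := C.length / 2) (by omega) (by omega)
  have h₃ := dist_getVert_le C (i + 1) (C.length / 2 - 1)
  have h₄ := hG.dist_triangle (u := C.getVert i) (v := v)
    (w := C.getVert (i + C.length / 2 + 1))
  have h₅ := dist_getVert_le C 0 i
  have h₆ := dist_getVert_le C (i + C.length / 2 + 1) (C.length - (i + C.length / 2 + 1))
  rw [show i + C.length / 2 + 1 + (C.length - (i + C.length / 2 + 1)) = C.length by omega,
    C.getVert_length, dist_comm] at h₆
  rw [Nat.zero_add, C.getVert_zero, dist_comm] at h₅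
  rw [show i + 1 + C.length / 2 = i + C.length / 2 + 1 by omega] at h₂
  rw [show i + 1 + (C.length / 2 - 1) = i + C.length / 2 by omega] at h₃
  omega

theorem src_add_two_le_of_shortest_cycle [Finite V] (hG : G.Connected) {v : V} {C : G.Walk v v}
    (hC : C.IsCycle) (hk : ∀ (v : V) (D : G.Walk v v), D.IsCycle → C.length ≤ D.length)
    (h4 : 4 ≤ C.length) : src G + 2 ≤ G.edgeSet.ncard := by
  have ne : ∀ i j, i < j → j < C.length →
    s(C.getVert i, C.getVert (i + 1)) ≠ s(C.getVert j, C.getVert (j + 1)) :=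
    fun i j => cycle_edge_ne hC
  have mem : ∀ i, i < C.length → s(C.getVert i, C.getVert (i + 1)) ∈ G.edgeSet :=
    fun i hi => C.adj_getVert_succ hi
  refine src_add_two_le_of_noCommonGeodesic hG ?_ ?_
    (noCommonGeodesic_of_antipodal hG hC hk (i := 0) h4 (by omega))
    (noCommonGeodesic_of_antipodal hG hC hk (i := 1) h4 (by omega))
  · simp only [List.forall_mem_cons, List.not_mem_nil, IsEmpty.forall_iff, implies_true, and_true]
    refine ⟨mem _ ?_, mem _ ?_, mem _ ?_, mem _ ?_⟩ <;> omega
  · simp only [List.nodup_cons, List.mem_cons, List.not_mem_nil, not_or, or_false, and_true,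
      not_false_eq_true, List.nodup_nil]
    refine ⟨⟨ne _ _ ?_ ?_, ne _ _ ?_ ?_, ne _ _ ?_ ?_⟩, ⟨ne _ _ ?_ ?_, ne _ _ ?_ ?_⟩,
      ne _ _ ?_ ?_⟩ <;> omega

/-- The antipodal pairs starting at the edges 0, 1, 2 are disjoint because half the length is at
least 3. -/
theorem src_add_three_le_of_shortest_cycle [Finite V] (hG : G.Connected) {v : V}
    {C : G.Walk v v} (hC : C.IsCycle)
    (hk : ∀ (v : V) (D : G.Walk v v), D.IsCycle → C.length ≤ D.length)
    (h6 : 6 ≤ C.length) : src G + 3 ≤ G.edgeSet.ncard := by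
  have ne : ∀ i j, i < j → j < C.length →
    s(C.getVert i, C.getVert (i + 1)) ≠ s(C.getVert j, C.getVert (j + 1)) :=
    fun i j => cycle_edge_ne hC
  have mem : ∀ i, i < C.length → s(C.getVert i, C.getVert (i + 1)) ∈ G.edgeSet :=
    fun i hi => C.adj_getVert_succ hi
  refine src_add_three_le_of_noCommonGeodesic hG ?_ ?_
    (noCommonGeodesic_of_antipodal hG hC hk (i := 0) (by omega) (by omega))
    (noCommonGeodesic_of_antipodal hG hC hk (i := 1) (by omega) (by omega))
    (noCommonGeodesic_of_antipodal hG hC hk (i := 2) (by omega) (by omega))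
  · simp only [List.forall_mem_cons, List.not_mem_nil, IsEmpty.forall_iff, implies_true, and_true]
    refine ⟨mem _ ?_, mem _ ?_, mem _ ?_, mem _ ?_, mem _ ?_, mem _ ?_⟩ <;> omega
  · simp only [List.nodup_cons, List.mem_cons, List.not_mem_nil, not_or, or_false, and_true,
      not_false_eq_true, List.nodup_nil]
    refine ⟨⟨ne _ _ ?_ ?_, ne _ _ ?_ ?_, ne _ _ ?_ ?_, ne _ _ ?_ ?_, ne _ _ ?_ ?_⟩,
      ⟨ne _ _ ?_ ?_, ne _ _ ?_ ?_, ne _ _ ?_ ?_, ne _ _ ?_ ?_⟩,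
      ⟨ne _ _ ?_ ?_, ne _ _ ?_ ?_, ne _ _ ?_ ?_⟩, ⟨ne _ _ ?_ ?_, ne _ _ ?_ ?_⟩,
      ne _ _ ?_ ?_⟩ <;> omega

theorem eq_univ_of_closed (hG : G.Connected) {S : Set V} {a : V} (ha : a ∈ S)
    (hS : ∀ x ∈ S, ∀ y, G.Adj x y → y ∈ S) (x : V) : x ∈ S := by
  obtain ⟨p⟩ := hG.preconnected a x
  induction p with
  | nil => exact ha
  | cons h p ih => exact ih (hS _ ha _ h)

theorem nonempty_iso_cycleGraph [Finite V] (hG : G.Connected) {v : V} {C : G.Walk v v}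
    (hC : C.IsCycle) (hk : ∀ (v : V) (D : G.Walk v v), D.IsCycle → C.length ≤ D.length)
    (h5 : C.length = 5) (hsrc : ¬ src G + 3 ≤ G.edgeSet.ncard) :
    Nonempty (G ≃g cycleGraph 5) := by
  have inj : ∀ m n, m < 5 → n < 5 → C.getVert m = C.getVert n → m = n :=
    fun m n hm hn h => hC.getVert_injOn' (by simp; omega) (by simp; omega) h
  have adj : ∀ i : Fin 5, G.Adj (C.getVert i) (C.getVert (i + 1 : Fin 5)) := by
    intro i
    fin_cases i
    · exact C.adj_getVert_succ (i := 0) (by omega)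
    · exact C.adj_getVert_succ (i := 1) (by omega)
    · exact C.adj_getVert_succ (i := 2) (by omega)
    · exact C.adj_getVert_succ (i := 3) (by omega)
    · have := C.adj_getVert_succ (i := 4) (by omega)
      rw [show 4 + 1 = C.length from h5.symm, C.getVert_length] at this
      simpa using this
  let f : Fin 5 → V := fun i => C.getVert i
  have finj : Function.Injective f := fun i j h => Fin.ext (inj _ _ i.2 j.2 h)
  have hd : ∀ i : Fin 5, G.dist (f i) (f (i + 1 + 1)) = 2 := fun i =>
    dist_eq_two hG hk (by omega) (adj i) (adj (i + 1))
      (fun h => by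
        have := finj h
        revert this
        clear * -
        revert i
        decide)
  have hout : ∀ (i : Fin 5) (w : V), G.Adj w (f i) → w ∈ Set.range f := by
    intro i w hw
    by_contra hwr
    have hw' : ∀ j, w ≠ f j := fun j h => hwr ⟨j, h.symm⟩
    -- The indices are cyclic in `Fin 5`, so the configuration attached at a covers all five
    -- vertices.
    have e₅ : i + 1 + 1 + 1 + 1 + 1 = i := by
      clear * -
      revert i
      decide
    have a₅ := adj (i + 1 + 1 + 1 + 1)
    have d₄ := hd (i + 1 + 1 + 1)
    have d₅ := hd (i + 1 + 1 + 1 + 1)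
    rw [e₅] at a₅ d₄ d₅
    exact hsrc (src_add_three_le_of_five_cycle hG (adj i) (adj (i + 1)) (adj (i + 1 + 1))
      (adj (i + 1 + 1 + 1)) a₅ (hd i) (hd (i + 1)) (hd (i + 1 + 1)) d₄ d₅ hw
      (hw' _) (hw' _) (hw' _) (hw' _))
  have fsurj : Function.Surjective f := fun x =>
    eq_univ_of_closed hG (S := Set.range f) ⟨0, rfl⟩
      (by rintro _ ⟨i, rfl⟩ y h; exact hout i y h.symm) x
  have hnadj : ∀ i : Fin 5, ¬ G.Adj (f i) (f (i + 1 + 1)) := fun i h => by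
    have := hd i
    rw [dist_eq_one h] at this
    omega
  refine ⟨(⟨Equiv.ofBijective f ⟨finj, fsurj⟩, ?_⟩ : cycleGraph 5 ≃g G).symm⟩
  intro i j
  change G.Adj (f i) (f j) ↔ _
  have cases : j = i ∨ j = i + 1 ∨ j = i + 1 + 1 ∨ i = j + 1 ∨ i = j + 1 + 1 := by
    clear * -
    revert i j
    decide
  have c₁ : ∀ i : Fin 5, (cycleGraph 5).Adj i (i + 1) := by decide
  have c₂ : ∀ i : Fin 5, ¬ (cycleGraph 5).Adj i (i + 1 + 1) := by decide
  rcases cases with rfl | rfl | rfl | rfl | rfl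
  · simp
  · exact iff_of_true (adj i) (c₁ i)
  · exact iff_of_false (hnadj i) (c₂ i)
  · exact iff_of_true (adj j).symm (c₁ j).symm
  · exact iff_of_false (fun h => hnadj j h.symm) (fun h => c₂ j h.symm)

/-! ### Uniqueness of the cycle -/

theorem mem_edges_of_toSubgraph_eq {u v : V} {C : G.Walk v v} {D : G.Walk u u}
    (h : D.toSubgraph = C.toSubgraph) {e : Sym2 V} : e ∈ D.edges ↔ e ∈ C.edges := by
  rw [← Walk.mem_edges_toSubgraph, h, Walk.mem_edges_toSubgraph]

theorem mem_edges_of_not_isBridge {v : V} {C : G.Walk v v} (hU : IsUniqueCycle C) {e : Sym2 V}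
    (he : e ∈ G.edgeSet) (hb : ¬ G.IsBridge e) : e ∈ C.edges := by
  rw [isBridge_iff_forall_cycle_notMem he] at hb
  push Not at hb
  obtain ⟨u, D, hD, heD⟩ := hb
  exact (mem_edges_of_toSubgraph_eq (hU.2 u D hD)).1 heD

theorem toSubgraph_eq_of_edges_iff {u v : V} {C : G.Walk v v} {D : G.Walk u u} (hC : C.IsCycle)
    (hD : D.IsCycle) (h : ∀ e, e ∈ D.edges ↔ e ∈ C.edges) : D.toSubgraph = C.toSubgraph := by
  ext x y
  · rw [Walk.mem_verts_toSubgraph, Walk.mem_verts_toSubgraph,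
      Walk.mem_support_iff_exists_mem_edges_of_not_nil hD.not_nil,
      Walk.mem_support_iff_exists_mem_edges_of_not_nil hC.not_nil]
    simp only [h]
  · rw [Walk.adj_toSubgraph_iff_mem_edges, Walk.adj_toSubgraph_iff_mem_edges, h]

/-- A shortest cycle which is not the only cycle misses an edge of some other cycle. -/
theorem exists_not_isBridge_of_not_isUniqueCycle {v : V} {C : G.Walk v v} (hC : C.IsCycle)
    (hk : ∀ (v : V) (D : G.Walk v v), D.IsCycle → C.length ≤ D.length)
    (hU : ¬ IsUniqueCycle C) :
    ∃ a b, G.Adj a b ∧ s(a, b) ∉ C.edges ∧ ¬ G.IsBridge s(a, b) := by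
  classical
  by_contra! hcon
  refine hU ⟨hC, fun w D hD => toSubgraph_eq_of_edges_iff hC hD ?_⟩
  -- If every edge off C is a bridge, the edges of D lie in C; as C is shortest, they are all the
  -- edges of C.
  have hsub : D.edges.toFinset ⊆ C.edges.toFinset := by
    intro e he
    rw [List.mem_toFinset] at he ⊢
    have heG := D.edges_subset_edgeSet he
    by_contra hn
    induction e using Sym2.inductionOn with | hf a b =>
    exact (hcon a b heG hn).notMem_edges_of_isCycle hD he
  have heq := Finset.eq_of_subset_of_card_le hsub (by
    rw [List.toFinset_card_of_nodup hD.isTrail.edges_nodup,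
      List.toFinset_card_of_nodup hC.isTrail.edges_nodup, Walk.length_edges, Walk.length_edges]
    exact hk w D hD)
  intro e
  rw [← List.mem_toFinset, heq, List.mem_toFinset]

theorem removeCycle_le {v : V} (C : G.Walk v v) : removeCycle C ≤ G := deleteEdges_le _

theorem removeCycle_adj {v : V} {C : G.Walk v v} {x y : V} :
    (removeCycle C).Adj x y ↔ G.Adj x y ∧ s(x, y) ∉ C.edges := by
  simp [removeCycle]

/-- A path off C between two of its vertices, closed by an arc of C, shows that its first edge is
not a bridge. That edge then lies on the unique cycle, a contradiction. -/
theorem not_reachable_removeCycle {v : V} {C : G.Walk v v} (hU : IsUniqueCycle C) {x y : V}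
    (hx : x ∈ C.support) (hy : y ∈ C.support) (hxy : x ≠ y) :
    ¬ (removeCycle C).Reachable x y := by
  classical
  intro hr
  obtain ⟨p, hp⟩ := hr.exists_isPath
  cases p with
  | nil => exact hxy rfl
  | @cons _ u _ h r =>
    rw [Walk.cons_isPath_iff] at hp
    have hadj := removeCycle_adj.1 h
    refine hadj.2 (mem_edges_of_not_isBridge hU hadj.1 ?_)
    rw [isBridge_iff_forall_walk_mem_edges]
    push Not
    have hy' : y ∈ (C.rotate x hx).support := by
      rwa [Walk.mem_support_rotate_iff]
    refine ⟨((C.rotate x hx).takeUntil y hy').append (r.mapLe (removeCycle_le C)).reverse, ?_⟩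
    rw [Walk.edges_append, List.mem_append, not_or]
    constructor
    · intro he
      have := (C.rotate x hx).edges_takeUntil_subset_edges hy' he
      rw [(C.rotate_edges x hx).mem_iff] at this
      exact hadj.2 this
    · rw [Walk.edges_reverse, List.mem_reverse]
      exact notMem_edges_left (by simpa using hp.2)

theorem exists_reachable_mem_support (hG : G.Connected) {v : V} (C : G.Walk v v) (x : V) :
    ∃ k ∈ C.support, (removeCycle C).Reachable x k := by
  obtain ⟨p⟩ := hG.preconnected x v
  induction p with
  | nil => exact ⟨_, C.start_mem_support, Reachable.refl _⟩
  | @cons x y v h p ih =>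
    by_cases hs : s(x, y) ∈ C.edges
    · exact ⟨x, C.fst_mem_support_of_mem_edges hs, Reachable.refl _⟩
    · obtain ⟨k, hk, hr⟩ := ih C
      exact ⟨k, hk, (removeCycle_adj.2 ⟨h, hs⟩).reachable.trans hr⟩

theorem isAcyclic_removeCycle {v : V} {C : G.Walk v v} (hU : IsUniqueCycle C) :
    (removeCycle C).IsAcyclic := by
  intro u D hD
  obtain ⟨e, he⟩ := D.edges.exists_mem_of_ne_nil (by simp [hD.not_nil])
  have h := mem_edges_of_toSubgraph_eq (e := e)
    (hU.2 u (D.mapLe (removeCycle_le C)) (hD.mapLe (removeCycle_le C)))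
  rw [Walk.edges_mapLe_eq_edges] at h
  have := D.edges_subset_edgeSet he
  rw [removeCycle, edgeSet_deleteEdges] at this
  exact this.2 (h.1 he)

/-! ### The trees attached to the cycle -/

theorem mem_tree_verts {v : V} {C : G.Walk v v} {x y : V} :
    y ∈ (tree C x).verts ↔ (removeCycle C).Reachable x y := by
  rw [reachable_comm]
  simp [tree]

theorem tree_adj {v : V} {C : G.Walk v v} {x y z : V} :
    (tree C x).Adj y z ↔ (removeCycle C).Reachable x y ∧ (removeCycle C).Adj y z := by
  constructor
  · intro h
    exact ⟨mem_tree_verts.1 h.fst_mem, h.adj_sub⟩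
  · rintro ⟨h₁, h₂⟩
    exact ⟨mem_tree_verts.2 h₁, mem_tree_verts.2 (h₁.trans h₂.reachable), h₂⟩

theorem nontrivialTree_iff {v : V} {C : G.Walk v v} {x : V} :
    NontrivialTree C x ↔ ∃ y, (removeCycle C).Adj x y := by
  constructor
  · intro h
    obtain ⟨y, hy, hne⟩ := h.exists_ne x
    rw [mem_tree_verts] at hy
    obtain ⟨p⟩ := hy
    cases p with
    | nil => exact absurd rfl hne
    | cons h p => exact ⟨_, h⟩
  · rintro ⟨y, hy⟩
    exact ⟨x, mem_tree_verts.2 (Reachable.refl _), y, mem_tree_verts.2 hy.reachable, hy.ne⟩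

theorem exists_attachment {v : V} {C : G.Walk v v} (hU : IsUniqueCycle C) {x : V}
    (hx : x ∈ C.support) (h : NontrivialTree C x) :
    ∃ w, G.Adj w x ∧ w ∉ C.support := by
  obtain ⟨w, hw⟩ := nontrivialTree_iff.1 h
  exact ⟨w, (removeCycle_le C hw).symm,
    fun hwC => not_reachable_removeCycle hU hx hwC hw.ne hw.reachable⟩

/-- If no vertex has two neighbors that are farther from `x`, then the component of `x` is a path
starting at `x`. -/
theorem exists_branching [Finite V] {H : SimpleGraph V} {x : V}
    (h : ¬ ∃ (y : V) (p : H.Walk x y), p.IsPath ∧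
      p.toSubgraph = (H.connectedComponentMk x).toSubgraph) :
    ∃ z z₁ z₂, z₁ ≠ z₂ ∧ H.Adj z z₁ ∧ H.Adj z z₂ ∧ H.Reachable x z ∧
      H.dist x z₁ = H.dist x z + 1 ∧ H.dist x z₂ = H.dist x z + 1 := by
  by_contra! hcon
  apply h
  -- Without branching every distance level has at most one vertex: two vertices on level n + 1 have
  -- neighbors on level n, which coincide by induction.
  have hlevel : ∀ n y z, H.Reachable x y → H.Reachable x z → H.dist x y = n → H.dist x z = n →
      y = z := by
    intro n
    induction n with
    | zero =>
      intro y z hy hz h₁ h₂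
      exact (hy.dist_eq_zero_iff.1 h₁).symm.trans (hz.dist_eq_zero_iff.1 h₂)
    | succ n ih =>
      have hpred : ∀ y, H.Reachable x y → H.dist x y = n + 1 →
          ∃ y', H.Adj y' y ∧ H.Reachable x y' ∧ H.dist x y' = n := by
        intro y hy h₁
        obtain ⟨p, hp⟩ := hy.symm.exists_walk_length_eq_dist
        rw [dist_comm, h₁] at hp
        cases p with
        | nil => simp at hp
        | @cons _ y' _ hadj q =>
          rw [Walk.length_cons] at hp
          have h₂ := dist_le q.reverse
          have h₃ := (hy.trans hadj.reachable).dist_triangle_left y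
          rw [dist_eq_one_iff_adj.2 hadj.symm, h₁] at h₃
          rw [Walk.length_reverse] at h₂
          exact ⟨y', hadj.symm, hy.trans hadj.reachable, by omega⟩
      intro y z hy hz h₁ h₂
      obtain ⟨y', hy', hry, hdy⟩ := hpred y hy h₁
      obtain ⟨z', hz', hrz, hdz⟩ := hpred z hz h₂
      obtain rfl := ih y' z' hry hrz hdy hdz
      by_contra hne
      exact hcon y' y z hne hy' hz' hry (by omega) (by omega)
  -- A geodesic to a farthest vertex meets every level, hence every vertex of the component.
  obtain ⟨y, hy, hmax⟩ := (Set.toFinite {y | H.Reachable x y}).exists_maximalFor (H.dist x) _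
    ⟨x, Reachable.refl x⟩
  obtain ⟨p, hp, hpl⟩ := Reachable.exists_path_of_dist (show H.Reachable x y from hy)
  have hpd : ∀ i ≤ p.length, H.dist x (p.getVert i) = i := by
    intro i hi
    have := length_eq_dist_of_subwalk hpl (p.isSubwalk_take i)
    rw [Walk.take_length, min_eq_left hi] at this
    exact this.symm
  have hget : ∀ z, H.Reachable x z → H.dist x z ≤ p.length ∧ z = p.getVert (H.dist x z) := by
    intro z hz
    have hle : H.dist x z ≤ p.length := by
      rw [hpl]
      rcases le_total (H.dist x z) (H.dist x y) with h | h
      · exact h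
      · exact hmax hz h
    exact ⟨hle, hlevel _ _ _ hz (p.take _).reachable rfl (hpd _ hle)⟩
  refine ⟨y, p, hp, ?_⟩
  have hmem : ∀ z, z ∈ (H.connectedComponentMk x).toSubgraph.verts ↔ H.Reachable x z := by
    intro z
    rw [reachable_comm]
    simp
  have hstep : ∀ u v, H.Reachable x u → H.Adj u v → H.dist x v = H.dist x u + 1 →
      s(u, v) ∈ p.edges := by
    intro u v hu huv hd
    obtain ⟨hle, hu'⟩ := hget u hu
    obtain ⟨hle', hv'⟩ := hget v (hu.trans huv.reachable)
    rw [hd] at hv' hle'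
    rw [hu', hv', ← Walk.adj_toSubgraph_iff_mem_edges]
    exact p.toSubgraph_adj_getVert (by omega)
  ext u w
  · rw [hmem, Walk.mem_verts_toSubgraph]
    constructor
    · intro hu
      classical
      exact (p.takeUntil u hu).reachable
    · intro hu
      rw [(hget u hu).2]
      exact p.getVert_mem_support _
  · rw [Walk.adj_toSubgraph_iff_mem_edges]
    constructor
    · intro huw
      have hu : H.Reachable x u := by
        classical
        exact (p.takeUntil u (p.fst_mem_support_of_mem_edges huw)).reachable
      have hadj := p.adj_of_mem_edges huw
      exact ⟨(hmem u).2 hu, (hmem w).2 (hu.trans hadj.reachable), hadj⟩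
    · intro huw
      have hu : H.Reachable x u := (hmem u).1 huw.fst_mem
      have hadj : H.Adj u w := huw.adj_sub
      have hw := hu.trans hadj.reachable
      have hne : H.dist x u ≠ H.dist x w := fun hd => hadj.ne (hlevel _ _ _ hu hw hd rfl)
      have h₁ := hw.dist_triangle_left u
      have h₂ := hu.dist_triangle_left w
      rw [dist_eq_one_iff_adj.2 hadj.symm] at h₁
      rw [dist_eq_one_iff_adj.2 hadj] at h₂
      rcases Nat.lt_or_gt_of_ne hne with hlt | hlt
      · exact hstep u w hu hadj (by omega)
      · rw [Sym2.eq_swap]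
        exact hstep w u hw hadj.symm (by omega)

theorem pathTree_of_not_nontrivialTree [Finite V] {v : V} {C : G.Walk v v} {x : V}
    (h : ¬ NontrivialTree C x) : PathTree C x := by
  by_contra hp
  obtain ⟨z, z₁, z₂, hne, h₁, h₂, hz, -⟩ := exists_branching hp
  exact h ⟨z₁, mem_tree_verts.2 (hz.trans h₁.reachable), z₂,
    mem_tree_verts.2 (hz.trans h₂.reachable), hne⟩

/-- If C is not unique, an edge off C lies on a cycle. By `exists_mate_or_reachable`, it has a mate
off C or two vertices of C are joined off C. In the latter case `hdist` gives the first edge of the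
joining path a mate, and `hmate` excludes both. -/
theorem isUniqueCycle_of_shortest (hG : G.Connected) {v : V} {C : G.Walk v v}
    (hC : C.IsCycle) (hk : ∀ (v : V) (D : G.Walk v v), D.IsCycle → C.length ≤ D.length)
    (hmate : ∀ e ∈ G.edgeSet, e ∉ C.edges → ∀ f ∈ G.edgeSet, f ∉ C.edges → f ≠ e →
      ¬ NoCommonGeodesic G e f)
    (hdist : ∀ x ∈ C.support, ∀ y ∈ C.support, x ≠ y → ∀ u, G.Adj x u → s(x, u) ∉ C.edges →
      G.dist x y ≤ G.dist u y) :
    IsUniqueCycle C := by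
  by_contra hU
  obtain ⟨a, b, hab, habC, hbr⟩ := exists_not_isBridge_of_not_isUniqueCycle hC hk hU
  rcases exists_mate_or_reachable hG C.edgeSet {x | x ∈ C.support}
      (fun e he x hx => C.mem_support_of_mem_edges he hx) hab habC hbr with
    ⟨f, hf, hfC, hne, hN⟩ | ⟨x, hx, y, hy, hxy, hr⟩
  · exact hmate _ hab habC f hf hfC hne hN
  · obtain ⟨p, hp⟩ := hr.exists_isPath
    cases p with
    | nil => exact hxy rfl
    | @cons _ u _ h p =>
      rw [Walk.cons_isPath_iff] at hp
      have hxu := removeCycle_adj.1 h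
      obtain ⟨f, hf, hfC, hne, hN⟩ := exists_mate_of_path hG C.edgeSet h p hp.2
        (hdist x hx y hy hxy u hxu.1 hxu.2)
      exact hmate _ hxu.1 hxu.2 f hf hfC hne hN

/-! ### Triangles -/

/-- The closed walk `C` runs around the triangle `abc`. -/
structure IsTriangle {v : V} (C : G.Walk v v) (a b c : V) : Prop where
  ab : G.Adj a b
  bc : G.Adj b c
  ca : G.Adj c a
  mem_support : ∀ x, x ∈ C.support ↔ x = a ∨ x = b ∨ x = c
  mem_edges : ∀ e, e ∈ C.edges ↔ e = s(a, b) ∨ e = s(b, c) ∨ e = s(c, a)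

theorem IsTriangle.rotate {v a b c : V} {C : G.Walk v v} (h : IsTriangle C a b c) :
    IsTriangle C b c a where
  ab := h.bc
  bc := h.ca
  ca := h.ab
  mem_support x := by rw [h.mem_support]; tauto
  mem_edges e := by rw [h.mem_edges]; tauto

theorem exists_isTriangle {v : V} (C : G.Walk v v) (hl : C.length = 3) :
    ∃ a b c, IsTriangle C a b c := by
  match C, hl with
  | .cons (v := b) h₁ (.cons (v := c) h₂ (.cons h₃ .nil)), _ =>
    exact ⟨v, b, c, h₁, h₂, h₃, by simp; tauto, by simp⟩

theorem isUniqueCycle_of_isTriangle [Finite V] (hG : G.Connected) {v a b c : V}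
    {C : G.Walk v v} (hC : C.IsCycle)
    (hk : ∀ (v : V) (D : G.Walk v v), D.IsCycle → C.length ≤ D.length)
    (h : IsTriangle C a b c) (hsrc : ¬ src G + 3 ≤ G.edgeSet.ncard) : IsUniqueCycle C := by
  refine isUniqueCycle_of_shortest hG hC hk (fun e he heC f hf hfC hne hN => hsrc ?_) ?_
  · rw [h.mem_edges] at heC hfC
    exact src_add_three_le_of_triangle hG h.ab h.bc h.ca.symm he hf (by simpa using heC)
      (by simpa using hfC) hne hN
  · intro x hx y hy hxy u hxu hxuC
    have hxyC : s(x, y) ∈ C.edges := by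
      rw [h.mem_support] at hx hy
      rw [h.mem_edges]
      grind
    rw [dist_eq_one (C.adj_of_mem_edges hxyC)]
    exact hG.pos_dist_of_ne (by rintro rfl; exact hxuC hxyC)

theorem classG1_of_isTriangle [Finite V] (hG : G.Connected) {v a b c : V} {C : G.Walk v v}
    (hU : IsUniqueCycle C) (hl : C.length = 3) (h : IsTriangle C a b c)
    (hsrc : ¬ src G + 3 ≤ G.edgeSet.ncard) : ClassG1 G := by
  have key : ∀ {a b c : V}, IsTriangle C a b c → ¬ NontrivialTree C a → ClassG1 G := by
    intro a b c h ha
    refine ⟨hG, v, C, hU, hl, (Set.encard_le_encard (t := {b, c}) ?_).trans ?_⟩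
    · rintro x ⟨hx, hN⟩
      rcases (h.mem_support x).1 hx with rfl | hx
      · exact absurd hN ha
      · exact hx
    · rw [Set.encard_pair h.bc.ne]
  by_cases ha : NontrivialTree C a
  · by_cases hb : NontrivialTree C b
    · by_cases hc : NontrivialTree C c
      · have hout : ∀ x ∈ C.support, NontrivialTree C x →
            ∃ w, G.Adj w x ∧ w ≠ a ∧ w ≠ b ∧ w ≠ c := by
          intro x hx hN
          obtain ⟨w, hw, hwC⟩ := exists_attachment hU hx hN
          rw [h.mem_support] at hwC
          tauto
        obtain ⟨w₁, h₁, -, h₁b, h₁c⟩ := hout a ((h.mem_support a).2 (by simp)) ha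
        obtain ⟨w₂, h₂, h₂a, -, h₂c⟩ := hout b ((h.mem_support b).2 (by simp)) hb
        obtain ⟨w₃, h₃, h₃a, h₃b, -⟩ := hout c ((h.mem_support c).2 (by simp)) hc
        exact absurd (src_add_three_le_of_triangle_attachments hG h.ab h.bc h.ca.symm h₁ h₂ h₃
          h₁b h₁c h₂a h₂c h₃a h₃b) hsrc
      · exact key h.rotate.rotate hc
    · exact key h.rotate hb
  · exact key h ha

/-- Deleting the two edges at the trivial root a leaves a forest with m - 2 edges. Geodesics between
its nonisolated vertices stay in it, as they can never profit from visiting a. -/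
theorem le_src_of_isTriangle [Finite V] (hG : G.Connected) {v a b c : V} {C : G.Walk v v}
    (hU : IsUniqueCycle C) (h : IsTriangle C a b c) (ha : ¬ NontrivialTree C a) :
    G.edgeSet.ncard ≤ src G + 2 := by
  have hnbr : ∀ w, G.Adj a w → w = b ∨ w = c := by
    intro w hw
    by_contra hbc
    refine ha (nontrivialTree_iff.2 ⟨w, removeCycle_adj.2 ⟨hw, ?_⟩⟩)
    rw [h.mem_edges]
    have := h.ab.ne
    have := h.ca.ne
    grind
  set S : Set (Sym2 V) := {s(a, b), s(c, a)} with hS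
  have hS' : S ⊆ G.edgeSet := by
    rintro e (rfl | rfl)
    exacts [h.ab, h.ca]
  have hSa : ∀ e ∈ S, a ∈ e := by
    rintro e (rfl | rfl) <;> simp
  have hisol : ∀ w, ¬ (G.deleteEdges S).Adj a w := by
    intro w hw
    rw [deleteEdges_adj] at hw
    rcases hnbr w hw.1 with rfl | rfl
    · exact hw.2 (by simp [hS])
    · exact hw.2 (by simp [hS])
  have hle := ncard_edgeSet_le_src hG (H := G.deleteEdges S) (deleteEdges_le _) ?_ ?_
  · rw [edgeSet_deleteEdges] at hle
    have h₁ := Set.ncard_sdiff_add_ncard_of_subset hS'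
    have h₂ : S.ncard ≤ 2 := by
      simpa using Set.ncard_insert_le s(a, b) {s(c, a)}
    omega
  · intro u D hD
    have h₁ := mem_edges_of_toSubgraph_eq (e := s(a, b))
      (hU.2 u (D.mapLe (deleteEdges_le _)) (hD.mapLe (deleteEdges_le _)))
    rw [Walk.edges_mapLe_eq_edges] at h₁
    exact hisol b (D.adj_of_mem_edges (h₁.2 ((h.mem_edges _).2 (Or.inl rfl))))
  · rintro x y ⟨x', hx⟩ ⟨y', hy⟩ p hp e he
    have hax : a ≠ x := by
      rintro rfl
      exact hisol _ hx
    have hay : a ≠ y := by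
      rintro rfl
      exact hisol _ hy
    rw [edgeSet_deleteEdges]
    refine ⟨p.edges_subset_edgeSet he, fun heS => ?_⟩
    have hap : a ∈ p.support := p.mem_support_of_mem_edges he (hSa e heS)
    obtain ⟨m, hm, hmx⟩ := exists_adj_dist_succ hG hax
    obtain ⟨n, hn, hny⟩ := exists_adj_dist_succ hG hay
    -- The neighbors of a before and after it on the geodesic are equal or adjacent, so skipping a
    -- is shorter.
    have hmn : G.dist m n ≤ 1 := by
      rcases hnbr m hm with rfl | rfl <;> rcases hnbr n hn with rfl | rfl
      · simp
      · rw [dist_eq_one h.bc]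
      · rw [dist_eq_one h.bc.symm]
      · simp
    have h₁ := hG.dist_triangle (u := x) (v := m) (w := y)
    have h₂ := hG.dist_triangle (u := m) (v := n) (w := y)
    have h₃ := geodesic_split hG hp hap hap
    rw [dist_comm (u := x) (v := m)] at h₁
    rw [dist_comm (u := x) (v := a)] at h₃
    omega

theorem le_src_of_classG1 [Finite V] (h : ClassG1 G) : G.edgeSet.ncard ≤ src G + 2 := by
  obtain ⟨hG, v, C, hU, hl, hN⟩ := h
  obtain ⟨a, b, c, h⟩ := exists_isTriangle C hl
  by_cases ha : NontrivialTree C a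
  · by_cases hb : NontrivialTree C b
    · by_cases hc : NontrivialTree C c
      · have hsub : ({a, b, c} : Set V) ⊆ nontrivialRoots C := by
          rintro x (rfl | rfl | rfl)
          exacts [⟨(h.mem_support _).2 (by simp), ha⟩, ⟨(h.mem_support _).2 (by simp), hb⟩,
            ⟨(h.mem_support _).2 (by simp), hc⟩]
        have h₃ : ({a, b, c} : Set V).encard = 3 :=
          Set.encard_eq_three.2 ⟨a, b, c, h.ab.ne, h.ca.ne.symm, h.bc.ne, rfl⟩
        have := (h₃ ▸ Set.encard_le_encard hsub).trans hN
        exact absurd this (by decide)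
      · exact le_src_of_isTriangle hG hU h.rotate.rotate hc
    · exact le_src_of_isTriangle hG hU h.rotate hb
  · exact le_src_of_isTriangle hG hU h ha

/-! ### Four-cycles -/

/-- The closed walk `C` runs around the four-cycle `abcd`. -/
structure IsFourCycle {v : V} (C : G.Walk v v) (a b c d : V) : Prop where
  ab : G.Adj a b
  bc : G.Adj b c
  cd : G.Adj c d
  da : G.Adj d a
  ac : a ≠ c
  bd : b ≠ d
  mem_support : ∀ x, x ∈ C.support ↔ x = a ∨ x = b ∨ x = c ∨ x = d
  mem_edges : ∀ e, e ∈ C.edges ↔ e = s(a, b) ∨ e = s(b, c) ∨ e = s(c, d) ∨ e = s(d, a)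

theorem IsFourCycle.rotate {v a b c d : V} {C : G.Walk v v} (h : IsFourCycle C a b c d) :
    IsFourCycle C b c d a where
  ab := h.bc
  bc := h.cd
  cd := h.da
  da := h.ab
  ac := h.bd
  bd := h.ac.symm
  mem_support x := by rw [h.mem_support]; tauto
  mem_edges e := by rw [h.mem_edges]; tauto

theorem exists_isFourCycle {v : V} {C : G.Walk v v} (hC : C.IsCycle) (hl : C.length = 4) :
    ∃ a b c d, IsFourCycle C a b c d := by
  match C, hC, hl with
  | .cons (v := b) h₁ (.cons (v := c) h₂ (.cons (v := d) h₃ (.cons h₄ .nil))), hC, _ =>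
    have hn := hC.support_nodup
    simp only [Walk.support_cons, Walk.support_nil, List.tail_cons, List.nodup_cons,
      List.mem_cons, List.not_mem_nil, not_or] at hn
    exact ⟨v, b, c, d, h₁, h₂, h₃, h₄, Ne.symm hn.2.1.2.1, hn.1.2.1, by simp; tauto, by simp⟩

theorem exists_isFourCycle_of_mem {v x : V} {C : G.Walk v v} (hC : C.IsCycle)
    (hl : C.length = 4) (hx : x ∈ C.support) : ∃ b c d, IsFourCycle C x b c d := by
  obtain ⟨a, b, c, d, h⟩ := exists_isFourCycle hC hl
  rcases (h.mem_support x).1 hx with rfl | rfl | rfl | rfl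
  exacts [⟨_, _, _, h⟩, ⟨_, _, _, h.rotate⟩, ⟨_, _, _, h.rotate.rotate⟩,
    ⟨_, _, _, h.rotate.rotate.rotate⟩]

theorem isUniqueCycle_of_isFourCycle [Finite V] (hG : G.Connected) {v a b c d : V}
    {C : G.Walk v v} (hC : C.IsCycle) (hl : C.length = 4)
    (hk : ∀ (v : V) (D : G.Walk v v), D.IsCycle → C.length ≤ D.length)
    (h : IsFourCycle C a b c d) (hsrc : ¬ src G + 3 ≤ G.edgeSet.ncard) : IsUniqueCycle C := by
  refine isUniqueCycle_of_shortest hG hC hk (fun e he heC f hf hfC hne hN => hsrc ?_) ?_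
  · rw [h.mem_edges] at heC hfC
    exact src_add_three_le_of_four_cycle hG h.ab h.bc h.cd h.da h.ac h.bd he hf
      (by simpa using heC) (by simpa using hfC) hne hN
  · intro x hx y hy hxy u hxu hxuC
    obtain ⟨b, c, d, h⟩ := exists_isFourCycle_of_mem hC hl hx
    have huy : u ≠ y ∨ y = c := by
      by_contra! hcon
      obtain ⟨rfl, hne⟩ := hcon
      rw [h.mem_support] at hy
      rw [h.mem_edges] at hxuC
      grind
    by_cases hyc : y = c
    · subst hyc
      have hd2 := dist_eq_two hG hk hl.ge h.ab h.bc hxy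
      rw [hd2]
      have huy : u ≠ y := by
        rintro rfl
        rw [dist_eq_one hxu] at hd2
        omega
      -- If u were adjacent to the opposite vertex, it would be a third common neighbor, completing
      -- a K_{2,3}.
      refine hG.one_lt_dist_of_ne_of_not_adj huy fun hadj => hsrc ?_
      have hub : u ≠ b := by
        rintro rfl
        exact hxuC ((h.mem_edges _).2 (by simp))
      have hud : u ≠ d := by
        rintro rfl
        exact hxuC ((h.mem_edges _).2 (by simp [Sym2.eq_swap]))
      exact src_add_three_le_of_three_common_neighbors hG hxy hub h.bd hud hxu h.ab h.da.symm
        hadj.symm h.bc.symm h.cd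
    · have hxyC : s(x, y) ∈ C.edges := by
        rw [h.mem_support] at hy
        rw [h.mem_edges]
        grind
      rw [dist_eq_one (C.adj_of_mem_edges hxyC)]
      exact hG.pos_dist_of_ne (by tauto)

/-- Folds the graph onto the line: a at 0 with its tree going down, c at 2 with its tree going up,
everything else at 1. The result is 1-Lipschitz and certifies distances across the cycle. -/
theorem exists_potential_of_isFourCycle {v a b c d : V} {C : G.Walk v v}
    (hU : IsUniqueCycle C) (h : IsFourCycle C a b c d) :
    ∃ ψ : V → ℤ, (∀ u w, G.Adj u w → ψ w ≤ ψ u + 1) ∧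
      (∀ u, (removeCycle C).Reachable a u → ψ u = -((removeCycle C).dist a u : ℤ)) ∧
      (∀ u, (removeCycle C).Reachable c u → ψ u = 2 + ((removeCycle C).dist c u : ℤ)) ∧
      ψ b = 1 ∧ ψ d = 1 := by
  classical
  set H := removeCycle C with hH
  have ma : a ∈ C.support := (h.mem_support a).2 (by simp)
  have mb : b ∈ C.support := (h.mem_support b).2 (by simp)
  have mc : c ∈ C.support := (h.mem_support c).2 (by simp)
  have md : d ∈ C.support := (h.mem_support d).2 (by simp)
  have hac := not_reachable_removeCycle hU ma mc h.ac
  have hab := not_reachable_removeCycle hU ma mb h.ab.ne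
  have had := not_reachable_removeCycle hU ma md h.da.ne.symm
  have hcb := not_reachable_removeCycle hU mc mb h.bc.ne.symm
  have hcd := not_reachable_removeCycle hU mc md h.cd.ne
  let ψ : V → ℤ := fun u => if H.Reachable a u then -(H.dist a u : ℤ)
    else if H.Reachable c u then 2 + (H.dist c u : ℤ) else 1
  have hψa : ∀ u, H.Reachable a u → ψ u = -(H.dist a u : ℤ) := fun u hu => if_pos hu
  have hψc : ∀ u, H.Reachable c u → ψ u = 2 + (H.dist c u : ℤ) := fun u hu => by
    have : ¬ H.Reachable a u := fun h' => hac (h'.trans hu.symm)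
    simp only [ψ, if_neg this, if_pos hu]
  have hψ1 : ∀ u, ¬ H.Reachable a u → ¬ H.Reachable c u → ψ u = 1 := fun u h₁ h₂ => by
    simp only [ψ, if_neg h₁, if_neg h₂]
  have ea : ψ a = 0 := by simp [hψa a (Reachable.refl _)]
  have ec : ψ c = 2 := by simp [hψc c (Reachable.refl _)]
  have eb : ψ b = 1 := hψ1 b hab hcb
  have ed : ψ d = 1 := hψ1 d had hcd
  refine ⟨ψ, fun u w huw => ?_, hψa, hψc, eb, ed⟩
  by_cases hC : s(u, w) ∈ C.edges
  · rw [h.mem_edges] at hC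
    simp only [Sym2.eq_iff] at hC
    rcases hC with (⟨rfl, rfl⟩ | ⟨rfl, rfl⟩) | (⟨rfl, rfl⟩ | ⟨rfl, rfl⟩) |
      (⟨rfl, rfl⟩ | ⟨rfl, rfl⟩) | (⟨rfl, rfl⟩ | ⟨rfl, rfl⟩) <;> omega
  · have hadj : H.Adj u w := removeCycle_adj.2 ⟨huw, hC⟩
    have h₁ := dist_eq_one hadj
    by_cases hau : H.Reachable a u
    · have haw := hau.trans hadj.reachable
      have h₂ := haw.dist_triangle_left u
      rw [dist_comm (u := w), h₁] at h₂
      rw [hψa u hau, hψa w haw]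
      omega
    have haw : ¬ H.Reachable a w := fun h' => hau (h'.trans hadj.symm.reachable)
    by_cases hcu : H.Reachable c u
    · have hcw := hcu.trans hadj.reachable
      have h₂ := hcu.dist_triangle_left w
      rw [h₁] at h₂
      rw [hψc u hcu, hψc w hcw]
      omega
    have hcw : ¬ H.Reachable c w := fun h' => hcu (h'.trans hadj.symm.reachable)
    rw [hψ1 u hau hcu, hψ1 w haw hcw]
    omega

theorem pathTree_of_isFourCycle [Finite V] (hG : G.Connected) {v a b c d : V} {C : G.Walk v v}
    (hU : IsUniqueCycle C) (h : IsFourCycle C a b c d)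
    (hsrc : ¬ src G + 3 ≤ G.edgeSet.ncard) : PathTree C a := by
  by_contra hp
  obtain ⟨z, z₁, z₂, hne, h₁, h₂, hz, hd₁, hd₂⟩ := exists_branching hp
  obtain ⟨ψ, hψ, hψa, hψc, hb, hd⟩ := exists_potential_of_isFourCycle hU h
  have hc := hψc c (Reachable.refl _)
  rw [dist_self] at hc
  -- The potential gives the lower bounds, and walking through a gives the upper bounds.
  have key : ∀ u, (removeCycle C).Reachable a u → ∀ n, (removeCycle C).dist a u = n →
      G.dist u b = n + 1 ∧ G.dist u d = n + 1 ∧ G.dist u c = n + 2 := by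
    rintro u hu n hn
    have e := hψa u hu
    rw [hn] at e
    have k₀ := hu.dist_anti (removeCycle_le C)
    rw [hn, dist_comm] at k₀
    have k₁ := dist_le_of_lipschitz hG ψ hψ u b
    have k₂ := dist_le_of_lipschitz hG ψ hψ u c
    have k₃ := dist_le_of_lipschitz hG ψ hψ u d
    have l₁ := hG.dist_triangle (u := u) (v := a) (w := b)
    have l₂ := hG.dist_triangle (u := u) (v := a) (w := d)
    have l₃ := hG.dist_triangle (u := u) (v := b) (w := c)
    rw [dist_eq_one h.ab] at l₁
    rw [dist_eq_one h.da.symm] at l₂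
    rw [dist_eq_one h.bc] at l₃
    omega
  obtain ⟨a₁, a₂, a₃⟩ := key z₁ (hz.trans h₁.reachable) _ hd₁
  obtain ⟨b₁, b₂, b₃⟩ := key z₂ (hz.trans h₂.reachable) _ hd₂
  exact hsrc (src_add_three_le_of_branching hG h.ab h.bc h.cd h.da h.ac h.bd
    (removeCycle_le C h₁) (removeCycle_le C h₂) hne (Nat.succ_ne_zero _) a₁ a₂ a₃ b₁ b₂ b₃)

theorem classG2_or_classG3_of_isFourCycle [Finite V] (hG : G.Connected) {v a b c d : V}
    {C : G.Walk v v} (hU : IsUniqueCycle C) (hl : C.length = 4) (h : IsFourCycle C a b c d)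
    (hsrc : ¬ src G + 3 ≤ G.edgeSet.ncard) : ClassG2 G ∨ ClassG3 G := by
  have hadj : ∀ {a b c d : V}, IsFourCycle C a b c d → NontrivialTree C a →
      ¬ NontrivialTree C b := by
    intro a b c d h ha hb
    obtain ⟨w, hw, hwC⟩ := exists_attachment hU ((h.mem_support a).2 (by simp)) ha
    obtain ⟨z, hz, hzC⟩ := exists_attachment hU ((h.mem_support b).2 (by simp)) hb
    rw [h.mem_support] at hwC hzC
    exact hsrc (src_add_three_le_of_adjacent_attachments hG h.ab h.bc h.cd h.da h.ac h.bd hw hz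
      (by tauto) (by tauto) (by tauto) (by tauto) (by tauto) (by tauto))
  -- Nontrivial trees cannot sit at adjacent vertices, so up to rotation b and d are trivial.
  have key : ∀ {a b c d : V}, IsFourCycle C a b c d → ¬ NontrivialTree C b →
      ¬ NontrivialTree C d → ClassG2 G ∨ ClassG3 G := by
    intro a b c d h hb hd
    have hsub : nontrivialRoots C ⊆ {a, c} := by
      rintro x ⟨hx, hN⟩
      rcases (h.mem_support x).1 hx with rfl | rfl | rfl | rfl
      · simp
      · exact absurd hN hb
      · simp
      · exact absurd hN hd
    have pa := pathTree_of_isFourCycle hG hU h hsrc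
    have pc := pathTree_of_isFourCycle hG hU h.rotate.rotate hsrc
    by_cases hac : NontrivialTree C a ∧ NontrivialTree C c
    · left
      refine ⟨hG, v, C, hU, hl, a, c, h.ac, ?_, hsub.antisymm ?_, pa, pc⟩
      · rw [Walk.adj_toSubgraph_iff_mem_edges, h.mem_edges]
        simp only [Sym2.eq_iff]
        have := h.ab.ne
        have := h.bc.ne
        have := h.cd.ne
        have := h.da.ne
        have := h.ac
        grind
      · rintro x (rfl | rfl)
        exacts [⟨(h.mem_support _).2 (by simp), hac.1⟩, ⟨(h.mem_support _).2 (by simp), hac.2⟩]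
    · right
      refine ⟨hG, v, C, hU, hl, Set.encard_le_one_iff_subsingleton.2 ?_, ?_⟩
      · intro x hx y hy
        rcases hsub hx with rfl | rfl <;> rcases hsub hy with rfl | rfl
        · rfl
        · exact absurd ⟨hx.2, hy.2⟩ hac
        · exact absurd ⟨hy.2, hx.2⟩ hac
        · rfl
      · intro x hx
        rcases hsub hx with rfl | rfl
        exacts [pa, pc]
  by_cases hb : NontrivialTree C b
  · refine key h.rotate (hadj h.rotate hb) fun ha => hadj h ha hb
  · by_cases hd : NontrivialTree C d
    · exact key h.rotate (fun hc => hadj h.rotate.rotate hc hd) (hadj h.rotate.rotate.rotate hd)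
    · exact key h hb hd

/-- The far ends of the two paths are at distance at least |p| + 2 + |q|, while the graph has at
most |p| + |q| + 4 edges. -/
theorem le_src_of_isFourCycle [Finite V] (hG : G.Connected) {v a b c d : V} {C : G.Walk v v}
    (hU : IsUniqueCycle C) (hl : C.length = 4) (h : IsFourCycle C a b c d) (pa : PathTree C a)
    (pc : PathTree C c) (hb : ¬ NontrivialTree C b) (hd : ¬ NontrivialTree C d) :
    G.edgeSet.ncard ≤ src G + 2 := by
  classical
  have hlen : ∀ {x y : V} (p : (removeCycle C).Walk x y), p.IsPath →
      p.length = (removeCycle C).dist x y := by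
    intro x y p hp
    obtain ⟨q, hq, hql⟩ := p.reachable.exists_path_of_dist
    have := congrArg Subtype.val
      (((isAcyclic_removeCycle hU).subsingleton_path x y).elim ⟨p, hp⟩ ⟨q, hq⟩)
    rw [← hql, ← show p = q from this]
  obtain ⟨y, p, hp, hpT⟩ := pa
  obtain ⟨z, q, hq, hqT⟩ := pc
  obtain ⟨ψ, hψ, hψa, hψc, -⟩ := exists_potential_of_isFourCycle hU h
  have hy := hψa y p.reachable
  have hz := hψc z q.reachable
  rw [← hlen p hp] at hy
  rw [← hlen q hq] at hz
  have hyz := dist_le_of_lipschitz hG ψ hψ y z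
  have hsrc := dist_le_src hG y z
  have hsub : G.edgeSet ⊆ ((p.edges ++ q.edges ++ C.edges).toFinset : Set (Sym2 V)) := by
    intro e he
    simp only [List.coe_toFinset, List.mem_append, Set.mem_ofPred_eq]
    by_cases heC : e ∈ C.edges
    · exact Or.inr heC
    left
    induction e using Sym2.inductionOn with | hf u w =>
    have hadj : (removeCycle C).Adj u w := removeCycle_adj.2 ⟨he, heC⟩
    obtain ⟨k, hk, hr⟩ := exists_reachable_mem_support hG C u
    have htriv : ¬ NontrivialTree C k → False := by
      intro hN
      refine hN ⟨u, mem_tree_verts.2 hr.symm, w,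
        mem_tree_verts.2 (hr.symm.trans hadj.reachable), hadj.ne⟩
    have htree := tree_adj.2 ⟨hr.symm, hadj⟩
    rcases (h.mem_support k).1 hk with rfl | rfl | rfl | rfl
    · left
      rwa [← hpT, Walk.adj_toSubgraph_iff_mem_edges] at htree
    · exact (htriv hb).elim
    · right
      rwa [← hqT, Walk.adj_toSubgraph_iff_mem_edges] at htree
    · exact (htriv hd).elim
  have hcard := Set.ncard_le_ncard hsub
  rw [Set.ncard_coe_finset] at hcard
  have hle := hcard.trans (List.toFinset_card_le _)
  simp only [List.length_append, Walk.length_edges, hl] at hle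
  omega

theorem le_src_of_classG2 [Finite V] (h : ClassG2 G) : G.edgeSet.ncard ≤ src G + 2 := by
  obtain ⟨hG, v, C, hU, hl, x, y, hxy, hadj, hroots, px, py⟩ := h
  have hx : x ∈ nontrivialRoots C := by simp [hroots]
  have hy : y ∈ nontrivialRoots C := by simp [hroots]
  obtain ⟨b, c, d, h⟩ := exists_isFourCycle_of_mem hU.1 hl hx.1
  rw [Walk.adj_toSubgraph_iff_mem_edges, h.mem_edges] at hadj
  have hyc : y = c := by
    rcases (h.mem_support y).1 hy.1 with rfl | rfl | rfl | rfl
    · exact absurd rfl hxy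
    · exact absurd (Or.inl rfl) hadj
    · rfl
    · exact absurd (by simp [Sym2.eq_swap]) hadj
  subst hyc
  have htriv : ∀ u ∈ C.support, u ≠ x → u ≠ y → ¬ NontrivialTree C u := by
    intro u hu h₁ h₂ hN
    have : u ∈ nontrivialRoots C := ⟨hu, hN⟩
    rw [hroots] at this
    rcases this with rfl | rfl
    exacts [h₁ rfl, h₂ rfl]
  exact le_src_of_isFourCycle hG hU hl h px py
    (htriv b ((h.mem_support _).2 (by simp)) h.ab.ne.symm h.bc.ne)
    (htriv d ((h.mem_support _).2 (by simp)) h.da.ne h.cd.ne.symm)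

theorem le_src_of_classG3 [Finite V] (h : ClassG3 G) : G.edgeSet.ncard ≤ src G + 2 := by
  obtain ⟨hG, v, C, hU, hl, hN, hP⟩ := h
  rw [Set.encard_le_one_iff_subsingleton] at hN
  have hpath : ∀ u ∈ C.support, PathTree C u := by
    intro u hu
    by_cases hNu : NontrivialTree C u
    · exact hP u ⟨hu, hNu⟩
    · exact pathTree_of_not_nontrivialTree hNu
  -- With no nontrivial tree any cycle vertex serves as x. The opposite root carries a trivial tree,
  -- which counts as a path.
  have key : ∃ x ∈ C.support, ∀ u ∈ C.support, u ≠ x → ¬ NontrivialTree C u := by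
    by_cases hne : (nontrivialRoots C).Nonempty
    · obtain ⟨x, hx⟩ := hne
      exact ⟨x, hx.1, fun u hu hux hNu => hux (hN ⟨hu, hNu⟩ hx)⟩
    · exact ⟨v, C.start_mem_support, fun u hu _ hNu => hne ⟨u, hu, hNu⟩⟩
  obtain ⟨x, hx, htriv⟩ := key
  obtain ⟨b, c, d, h⟩ := exists_isFourCycle_of_mem hU.1 hl hx
  exact le_src_of_isFourCycle hG hU hl h (hpath x hx) (hpath c ((h.mem_support _).2 (by simp)))
    (htriv b ((h.mem_support _).2 (by simp)) h.ab.ne.symm)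
    (htriv d ((h.mem_support _).2 (by simp)) h.da.ne)

/-! ### The classification -/

theorem exists_shortest_cycle (h : ¬ G.IsAcyclic) : ∃ (v : V) (C : G.Walk v v), C.IsCycle ∧
    ∀ (w : V) (D : G.Walk w w), D.IsCycle → C.length ≤ D.length := by
  obtain ⟨v, C, hC, hl⟩ := exists_girth_eq_length.2 h
  exact ⟨v, C, hC, fun w D hD => hl ▸ girth_le_length hD⟩

theorem src_add_two_le_of_not_isAcyclic [Finite V] (hG : G.Connected) (h : ¬ G.IsAcyclic) :
    src G + 2 ≤ G.edgeSet.ncard := by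
  obtain ⟨v, C, hC, hk⟩ := exists_shortest_cycle h
  have h3 := hC.three_le_length
  rcases Nat.lt_or_ge C.length 4 with hlt | h4
  · obtain ⟨a, b, c, ht⟩ := exists_isTriangle C (by omega)
    exact src_add_two_le_of_triangle hG ht.ab ht.bc ht.ca.symm
  · exact src_add_two_le_of_shortest_cycle hG hC hk h4

theorem src_add_three_le_or_mem_class [Finite V] (hG : G.Connected) (h : ¬ G.IsAcyclic) :
    src G + 3 ≤ G.edgeSet.ncard ∨ Nonempty (G ≃g cycleGraph 5) ∨ ClassG1 G ∨ ClassG2 G ∨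
      ClassG3 G := by
  rw [or_iff_not_imp_left]
  intro hsrc
  obtain ⟨v, C, hC, hk⟩ := exists_shortest_cycle h
  have h3 := hC.three_le_length
  have h6 : C.length < 6 := by
    by_contra h6
    exact hsrc (src_add_three_le_of_shortest_cycle hG hC hk (by omega))
  obtain hl | hl | hl : C.length = 3 ∨ C.length = 4 ∨ C.length = 5 := by omega
  · obtain ⟨a, b, c, ht⟩ := exists_isTriangle C hl
    exact Or.inr (Or.inl (classG1_of_isTriangle hG
      (isUniqueCycle_of_isTriangle hG hC hk ht hsrc) hl ht hsrc))
  · obtain ⟨a, b, c, d, hf⟩ := exists_isFourCycle hC hl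
    exact Or.inr (Or.inr (classG2_or_classG3_of_isFourCycle hG
      (isUniqueCycle_of_isFourCycle hG hC hl hk hf hsrc) hl hf hsrc))
  · exact Or.inl (nonempty_iso_cycleGraph hG hC hk hl hsrc)

theorem not_isAcyclic_and_le_src_of_mem_class [Finite V] (hG : G.Connected)
    (h : Nonempty (G ≃g cycleGraph 5) ∨ ClassG1 G ∨ ClassG2 G ∨ ClassG3 G) :
    ¬ G.IsAcyclic ∧ G.edgeSet.ncard ≤ src G + 2 := by
  rcases h with ⟨⟨φ⟩⟩ | h | h | h
  · have := three_le_src_of_iso_cycleGraph hG φ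
    exact ⟨not_isAcyclic_of_iso_cycleGraph φ, by rw [ncard_edgeSet_of_iso_cycleGraph φ]; omega⟩
  · obtain ⟨-, v, C, hU, -⟩ := id h
    exact ⟨fun hA => hA C hU.1, le_src_of_classG1 h⟩
  · obtain ⟨-, v, C, hU, -⟩ := id h
    exact ⟨fun hA => hA C hU.1, le_src_of_classG2 h⟩
  · obtain ⟨-, v, C, hU, -⟩ := id h
    exact ⟨fun hA => hA C hU.1, le_src_of_classG3 h⟩

end StrongRainbow

theorem theorem1 {V : Type*} [Finite V] (G : SimpleGraph V) (hG : G.Connected) :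
    ((StrongRainbow.src G : ℤ) ≤ (G.edgeSet.ncard : ℤ) - 2 ↔ ¬ G.IsTree) ∧
    (StrongRainbow.src G : ℤ) ≠ (G.edgeSet.ncard : ℤ) - 1 ∧
    ((StrongRainbow.src G : ℤ) = (G.edgeSet.ncard : ℤ) - 2 ↔
      Nonempty (G ≃g SimpleGraph.cycleGraph 5) ∨ StrongRainbow.ClassG1 G ∨
        StrongRainbow.ClassG2 G ∨ StrongRainbow.ClassG3 G) := by
  have hclass := StrongRainbow.not_isAcyclic_and_le_src_of_mem_class hG
  by_cases hA : G.IsAcyclic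
  · have hT : G.IsTree := ⟨hG, hA⟩
    -- For a tree, m ≤ src alone rules out both values m - 1 and m - 2.
    have := StrongRainbow.ncard_edgeSet_le_src_of_isTree hT
    exact ⟨iff_of_false (by omega) (not_not.2 hT), by omega,
      iff_of_false (by omega) fun h => (hclass h).1 hA⟩
  · have h₂ := StrongRainbow.src_add_two_le_of_not_isAcyclic hG hA
    have h₃ := StrongRainbow.src_add_three_le_or_mem_class hG hA
    refine ⟨iff_of_true (by omega) fun hT => hA hT.isAcyclic, by omega, fun h => ?_, fun h => ?_⟩
    · exact h₃.resolve_left (by omega)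
    · have := (hclass h).2
      omega
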